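/- Let $G=(A\cup B,E)$ be a bipartite graph with $|A|=|B|=n$ in which every agent $a\in A$ has a strict partial order $\succ_a$ on her neighbours. For perfect matchings $M,N$ of $G$ let $\phi(M,N)$ be the number of agents $a$ with $M(a)\succ_a N(a)$; a perfect matching $M$ is a \emph{popular assignment} if $\phi(M,N)\ge\phi(N,M)$ for all perfect matchings $N$ of $G$. Let $F^+\subseteq E$ be a set of forced edges and $F^-\subseteq E$ a set of forbidden edges; a \emph{solution} is a popular assignment $M$ in $G$ with $F^+\subseteq M$ and $F^-\cap M=\emptyset$. Put $F=F^-\cup\{(a,b')\in E:(a,b)\in F^+\text{ for some } b\ne b'\}$. For a level function $\ell:B\to\mathbb N$ let $\ell^*(a)$ be the maximum of $\ell$ over the neighbours of $a$ in $G$, and let $G_\ell=(A\cup B,E_\ell)$, where an edge $(a,b)\in E$ is in $E_\ell$ iff either (i) $\ell(b)=\ell^*(a)$ and $a$ prefers no neighbour in level $\ell^*(a)$ to $b$, or (ii) $\ell(b)=\ell^*(a)-1$, $a$ prefers $b$ to all her neighbours in level $\ell^*(a)$, and $a$ prefers no neighbour in level $\ell^*(a)-1$ to $b$. The \emph{level algorithm}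 starts with $\ell=0$; as long as $\ell(b)<n$ for all $b\in B$, it computes a maximum matching $M$ in $G_\ell-F$, returns $M$ if $M$ is perfect, and otherwise increases $\ell(b)$ by $1$ for all $b\in B$ unmatched in $M$. If the loop ends without returning a matching, it answers that there is no solution. (1) Whatever maximum matchings are chosen, the level algorithm makes at most $n^2$ iterations that do not return a matching; every matching that it returns is a solution; and if a solution exists, then it returns a solution. (2) It can be decided in polynomial time whether a solution exists: there are a program for a random access machine (with addition and subtraction at unit cost, and no multiplication) and a polynomial $p$ such that, for all $n$ and all instances $(G,(\succ_a)_{a\in A},F^+,F^-)$ with $|A|=|B|=n$, the program, given the tables of $E,F^+,F^-$ and $(\succ_a)_{a\in A}$, halts after at most $p(n)$ steps, accepts if and only if a solution exists, and outputs a result of the level algorithm, i.e. one that the level algorithm produces for some choice of its maximum matchings (a solution if there is one, and the answer that there is none otherwise). -/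

import Mathlib

namespace PopAssign

/-! ### Instances, matchings, popularity -/

/-- An instance: a bipartite graph with `n` agents and `n` objects (both numbered by `Fin n`),
edge set `E`, for each agent `a` a strict partial order `pref a` on the neighbours of `a`
(`pref a b b'` means that `a` prefers `b` to `b'`), a set of forced edges and a set of
forbidden edges. -/
structure Instance (n : ℕ) where
  E : Finset (Fin n × Fin n)
  pref : Fin n → Fin n → Fin n → Prop
  pref_nbr : ∀ a b b', pref a b b' → (a, b) ∈ E ∧ (a, b') ∈ E
  pref_irrefl : ∀ a b, ¬ pref a b b
  pref_trans : ∀ a b₁ b₂ b₃, pref a b₁ b₂ → pref a b₂ b₃ → pref a b₁ b₃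
  forced : Finset (Fin n × Fin n)
  forbidden : Finset (Fin n × Fin n)
  forced_subset : forced ⊆ E
  forbidden_subset : forbidden ⊆ E

/-- `M` is a matching using only edges of `D`. -/
def IsMatching {n : ℕ} (D M : Finset (Fin n × Fin n)) : Prop :=
  M ⊆ D ∧ ∀ e ∈ M, ∀ f ∈ M, (e.1 = f.1 ∨ e.2 = f.2) → e = f

/-- `M` is a perfect matching of the graph with edge set `D`. -/
def IsPerfect {n : ℕ} (D M : Finset (Fin n × Fin n)) : Prop :=
  IsMatching D M ∧ (∀ a, ∃ b, (a, b) ∈ M) ∧ (∀ b, ∃ a, (a, b) ∈ M)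

/-- `M` is a maximum matching of the graph with edge set `D`. -/
def IsMaximum {n : ℕ} (D M : Finset (Fin n × Fin n)) : Prop :=
  IsMatching D M ∧ ∀ N, IsMatching D N → N.card ≤ M.card

namespace Instance

variable {n : ℕ} (I : Instance n)

open Classical in
/-- The number of agents who prefer the matching `M` to the matching `N`
(being unmatched is the worst choice of every agent). -/
noncomputable def phi (M N : Finset (Fin n × Fin n)) : ℕ :=
  (Finset.univ.filter fun a : Fin n =>
    ∃ b, (a, b) ∈ M ∧ ∀ b', (a, b') ∈ N → I.pref a b b').card

/-- `M` is a popular assignment: a perfect matching of the whole graph such that no perfect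
matching of the whole graph is more popular. -/
def IsPopularAssignment (M : Finset (Fin n × Fin n)) : Prop :=
  IsPerfect I.E M ∧ ∀ N, IsPerfect I.E N → (0 : ℤ) ≤ (I.phi M N : ℤ) - (I.phi N M : ℤ)

/-- `M` is a popular assignment that contains all forced edges and no forbidden edge. -/
def IsSolution (M : Finset (Fin n × Fin n)) : Prop :=
  I.IsPopularAssignment M ∧ I.forced ⊆ M ∧ Disjoint I.forbidden M

/-! ### The level algorithm -/

/-- The set `F` of excluded edges: the forbidden edges, and for every forced edge `(a, b)` all the
other edges at `a`. -/
def F : Finset (Fin n × Fin n) :=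
  I.forbidden ∪ I.E.filter fun e => ∃ f ∈ I.forced, f.1 = e.1 ∧ f.2 ≠ e.2

/-- The highest level at which the agent `a` has neighbours. -/
def topLevel (l : Fin n → ℕ) (a : Fin n) : ℕ :=
  (Finset.univ.filter fun b => (a, b) ∈ I.E).sup l

open Classical in
/-- The edge set of the subgraph `G_l` induced by the level function `l`. -/
noncomputable def levelEdges (l : Fin n → ℕ) : Finset (Fin n × Fin n) :=
  I.E.filter fun e =>
    (l e.2 = I.topLevel l e.1 ∧
      ∀ b, (e.1, b) ∈ I.E → l b = I.topLevel l e.1 → ¬ I.pref e.1 b e.2) ∨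
    (l e.2 + 1 = I.topLevel l e.1 ∧
      (∀ b, (e.1, b) ∈ I.E → l b = I.topLevel l e.1 → I.pref e.1 e.2 b) ∧
      ∀ b, (e.1, b) ∈ I.E → l b + 1 = I.topLevel l e.1 → ¬ I.pref e.1 b e.2)

/-- The new level function: the level of every object unmatched in `M` goes up by one. -/
def raise (l : Fin n → ℕ) (M : Finset (Fin n × Fin n)) (b : Fin n) : ℕ :=
  if ∃ a, (a, b) ∈ M then l b else l b + 1

/-- `I.Reach k l`: the level algorithm on `G_l - F`, with some choice of the maximum matchings that
it computes, has level function `l` after `k` iterations of its loop none of which returned.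
An iteration is made only while all levels are below `n`; it computes a maximum matching `M` of
`G_l - F`, returns `M` if `M` is perfect, and raises the levels otherwise. -/
inductive Reach : ℕ → (Fin n → ℕ) → Prop
  | start : Reach 0 (fun _ => 0)
  | next (k : ℕ) (l : Fin n → ℕ) (M : Finset (Fin n × Fin n)) :
      Reach k l → (∀ b, l b < n) → IsMaximum (I.levelEdges l \ I.F) M →
      ¬ IsPerfect (I.levelEdges l \ I.F) M → Reach (k + 1) (raise l M)

/-- `I.Returns r`: some run of the level algorithm returns `r`, where `none` is the answer that
there is no solution. -/
def Returns : Option (Finset (Fin n × Fin n)) → Prop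
  | none => ∃ k l, I.Reach k l ∧ ¬ ∀ b, l b < n
  | some M => ∃ k l, I.Reach k l ∧ (∀ b, l b < n) ∧
      IsMaximum (I.levelEdges l \ I.F) M ∧ IsPerfect (I.levelEdges l \ I.F) M

end Instance

/-! ### Random access machines with a step count

Programs work on registers and on arrays of natural numbers. A program is a finite term, so it
mentions only finitely many registers and arrays. The only arithmetic operations are addition and
truncated subtraction, at unit cost; there is no multiplication, so in one unit of time the bit
length of the largest stored number grows by at most one, up to an additive constant that depends on
the program, and polynomial time on this machine is polynomial time on a Turing machine. -/

/-- The memory: registers `reg i` and arrays `arr j`. -/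
structure Store where
  reg : ℕ → ℕ
  arr : ℕ → ℕ → ℕ

/-- Expressions; `get j e` reads the entry of array `j` at the address `e`. -/
inductive Expr where
  | const (c : ℕ)
  | reg (i : ℕ)
  | get (j : ℕ) (e : Expr)
  | add (e f : Expr)
  | sub (e f : Expr)

namespace Expr

/-- The value of an expression. -/
def eval (s : Store) : Expr → ℕ
  | const c => c
  | reg i => s.reg i
  | get j e => s.arr j (e.eval s)
  | add e f => e.eval s + f.eval s
  | sub e f => e.eval s - f.eval s

/-- The time that it takes to evaluate an expression: one unit for each operation in it. -/
def cost : Expr → ℕ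
  | const _ => 1
  | reg _ => 1
  | get _ e => e.cost + 1
  | add e f => e.cost + f.cost + 1
  | sub e f => e.cost + f.cost + 1

end Expr

/-- Programs; a condition `e` holds when its value is not `0`. -/
inductive Prog where
  | skip
  | set (i : ℕ) (e : Expr)
  | put (j : ℕ) (e f : Expr)
  | seq (p q : Prog)
  | ite (e : Expr) (p q : Prog)
  | loop (e : Expr) (p : Prog)

/-- `Exec p s t s'`: started on `s`, the program `p` halts after `t` units of time, with memory
`s'`. -/
inductive Exec : Prog → Store → ℕ → Store → Prop
  | skip (s : Store) : Exec Prog.skip s 1 s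
  | set (i : ℕ) (e : Expr) (s : Store) :
      Exec (Prog.set i e) s (e.cost + 1)
        { s with reg := Function.update s.reg i (e.eval s) }
  | put (j : ℕ) (e f : Expr) (s : Store) :
      Exec (Prog.put j e f) s (e.cost + f.cost + 1)
        { s with arr :=
            Function.update s.arr j (Function.update (s.arr j) (e.eval s) (f.eval s)) }
  | seq (p q : Prog) (s s' s'' : Store) (t t' : ℕ) :
      Exec p s t s' → Exec q s' t' s'' → Exec (Prog.seq p q) s (t + t') s''
  | iteTrue (e : Expr) (p q : Prog) (s s' : Store) (t : ℕ) :
      e.eval s ≠ 0 → Exec p s t s' → Exec (Prog.ite e p q) s (e.cost + 1 + t) s'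
  | iteFalse (e : Expr) (p q : Prog) (s s' : Store) (t : ℕ) :
      e.eval s = 0 → Exec q s t s' → Exec (Prog.ite e p q) s (e.cost + 1 + t) s'
  | loopTrue (e : Expr) (p : Prog) (s s' s'' : Store) (t t' : ℕ) :
      e.eval s ≠ 0 → Exec p s t s' → Exec (Prog.loop e p) s' t' s'' →
      Exec (Prog.loop e p) s (e.cost + 1 + t + t') s''
  | loopFalse (e : Expr) (p : Prog) (s : Store) :
      e.eval s = 0 → Exec (Prog.loop e p) s (e.cost + 1) s

open Classical in
/-- The input for an instance: register `0` holds `n`; arrays `0`, `1`, `2` are the `n × n` tables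
(in row-major order) of the edges, the forced edges and the forbidden edges; array `3` is the
`n × n × n` table of the preferences; everything else is `0`. -/
noncomputable def Instance.input {n : ℕ} (I : Instance n) : Store where
  reg i := if i = 0 then n else 0
  arr j x :=
    if j = 0 then
      if ∃ a b : Fin n, x = a.val * n + b.val ∧ (a, b) ∈ I.E then 1 else 0
    else if j = 1 then
      if ∃ a b : Fin n, x = a.val * n + b.val ∧ (a, b) ∈ I.forced then 1 else 0
    else if j = 2 then
      if ∃ a b : Fin n, x = a.val * n + b.val ∧ (a, b) ∈ I.forbidden then 1 else 0
    else if j = 3 then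
      if ∃ a b b' : Fin n, x = (a.val * n + b.val) * n + b'.val ∧ I.pref a b b' then 1 else 0
    else 0

/-- The output `r` as it is left in memory: register `0` holds `0` if there is no solution;
otherwise it holds `1`, and array `0` lists the partners of the agents `0, …, n - 1`. -/
def Store.Shows {n : ℕ} (s : Store) : Option (Finset (Fin n × Fin n)) → Prop
  | none => s.reg 0 = 0
  | some M => s.reg 0 = 1 ∧ ∀ a b : Fin n, (a, b) ∈ M ↔ s.arr 0 a.val = b.val

end PopAssign

namespace PopAssign

/-! ### Perfect matchings as permutations -/

/-! Levels are dual certificates for popularity. An edge `(a, b)` lies in `G_l` exactly when `l b' +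
[b' ≻ b] ≤ l b + [b ≻ b']` for all neighbours `b'` of `a` (`mem_levelEdges_iff`). Summed over a
perfect matching of `G_l`, the levels cancel and popularity remains. Conversely, let `M` be popular
and draw an arc from `b` to `b'` if the partner of `b` is adjacent to `b'`, weighted by her vote for
`b'` against `b`. A positive cycle would give a more popular perfect matching, so the weights of
heaviest simple paths form a potential (`exists_potential`); as weights are at most 1, it stays
below `n`.

The set `F` encodes the side constraints: solutions avoid `F`, and every perfect matching of `G_l -
F` is a solution. If `l₀` are levels of some solution, then `l ≤ l₀` throughout a run: an unmatched
object with `l b = l₀ b` would allow an exchange with the solution that enlarges the maximum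
matching (`IsSolution.raise_le`). Hence no level reaches `n` when a solution exists. Each iteration
that does not return raises the sum of the levels, which gives the bound `n ^ 2`.

For the program, maximum matchings are found by an auction with unit price increments, whose
optimality follows from a gap in the prices (`AuctionInv.isMaximum`). Running times come from a
small Hoare logic with time bounds and a frame rule (`Runs`, `Agree`). Multiplication is needed only
for table addresses and is replaced by a table of multiples of `n`. -/

theorem IsPerfect.exists_perm {n : ℕ} {D M : Finset (Fin n × Fin n)} (h : IsPerfect D M) :
    ∃ σ : Equiv.Perm (Fin n), ∀ a b, (a, b) ∈ M ↔ σ a = b := by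
  obtain ⟨⟨-, hM⟩, ha, hb⟩ := h
  choose f hf using ha
  have hfM : ∀ a b, (a, b) ∈ M ↔ f a = b := fun a b =>
    ⟨fun hab => (Prod.ext_iff.1 (hM _ (hf a) _ hab (Or.inl rfl))).2, fun hab => hab ▸ hf a⟩
  have hsurj : Function.Surjective f := fun b => by
    obtain ⟨a, ha⟩ := hb b
    exact ⟨a, (hfM a b).1 ha⟩
  exact ⟨Equiv.ofBijective f (Finite.surjective_iff_bijective.1 hsurj), hfM⟩

/-- The graph of a permutation, as a set of edges. -/
def permGraph {n : ℕ} (σ : Equiv.Perm (Fin n)) : Finset (Fin n × Fin n) :=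
  Finset.univ.filter fun e => σ e.1 = e.2

theorem mem_permGraph {n : ℕ} (σ : Equiv.Perm (Fin n)) (a b : Fin n) :
    (a, b) ∈ permGraph σ ↔ σ a = b := by
  simp [permGraph]

theorem isPerfect_of_perm {n : ℕ} {D M : Finset (Fin n × Fin n)} {σ : Equiv.Perm (Fin n)}
    (hM : ∀ a b, (a, b) ∈ M ↔ σ a = b) (hD : ∀ a, (a, σ a) ∈ D) : IsPerfect D M := by
  refine ⟨⟨?_, ?_⟩, fun a => ⟨σ a, (hM _ _).2 rfl⟩, fun b => ⟨σ.symm b, (hM _ _).2 (by simp)⟩⟩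
  · rintro ⟨a, b⟩ h
    rw [hM] at h
    exact h ▸ hD a
  · rintro ⟨a, b⟩ h ⟨a', b'⟩ h' heq
    rw [hM] at h h'
    rcases heq with heq | heq
    · obtain rfl : a = a' := heq
      rw [← h, ← h']
    · obtain rfl : b = b' := heq
      rw [σ.injective (h.trans h'.symm)]

/-- A matching that covers all objects is perfect. -/
theorem IsMatching.isPerfect {n : ℕ} {D M : Finset (Fin n × Fin n)} (h : IsMatching D M)
    (hb : ∀ b, ∃ a, (a, b) ∈ M) : IsPerfect D M := by
  refine ⟨h, fun a => ?_, hb⟩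
  choose g hg using hb
  have hinj : Function.Injective g := fun b b' hbb =>
    (Prod.ext_iff.1 (h.2 _ (hg b) _ (hg b') (Or.inl hbb))).2
  obtain ⟨b, rfl⟩ := (Finite.injective_iff_surjective.1 hinj) a
  exact ⟨b, hg b⟩

/-! ### Potentials in graphs without positive cycles -/

section Potential

variable {β : Type*} (w : β → β → ℤ)

/-- The total weight of the steps of a path. -/
def pathWeight : List β → ℤ
  | [] => 0
  | [_] => 0
  | x :: y :: t => w x y + pathWeight (y :: t)

theorem pathWeight_append (x : β) (P Q : List β) :
    pathWeight w (P ++ x :: Q) = pathWeight w (P ++ [x]) + pathWeight w (x :: Q) := by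
  induction P with
  | nil => simp [pathWeight]
  | cons y P ih =>
    cases P with
    | nil => simp [pathWeight]
    | cons z P =>
      simp only [List.cons_append, pathWeight] at ih ⊢
      rw [ih, add_assoc]

/-- A path has one step fewer than vertices. This strictness is what keeps the levels below `n`. -/
theorem pathWeight_lt_length (hw : ∀ x y, w x y ≤ 1) (x : β) (t : List β) :
    pathWeight w (x :: t) < (x :: t).length := by
  induction t generalizing x with
  | nil => simp [pathWeight]
  | cons y t ih =>
    have h1 := hw x y
    have h2 := ih y
    simp only [pathWeight, List.length_cons] at h2 ⊢
    push_cast at h2 ⊢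
    linarith

variable [Fintype β] [DecidableEq β] {R : β → β → Prop}

/-- A simple path from `x` to `z` closes up to a permutation that maps `z` to `x`. -/
theorem exists_perm_of_path (hR : ∀ x, R x x) (hw : ∀ x, w x x = 0) (z : β) (P : List β) (x : β)
    (hx : (P ++ [z]).head? = some x)
    (hP : (P ++ [z]).Nodup) (hc : (P ++ [z]).IsChain R) :
    ∃ π : Equiv.Perm β, (∀ y, y ∉ P ++ [z] → π y = y) ∧ π z = x ∧
      (∀ y, y ≠ z → R y (π y)) ∧
      ∑ y ∈ Finset.univ.erase z, w y (π y) = pathWeight w (P ++ [z]) := by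
  induction P generalizing x with
  | nil =>
    refine ⟨1, fun _ _ => rfl, ?_, fun y _ => hR y, ?_⟩
    · simpa using hx
    · simp [pathWeight, hw]
  | cons u P ih =>
    obtain ⟨y, t, hyt⟩ : ∃ y t, P ++ [z] = y :: t := by
      cases P with
      | nil => exact ⟨z, [], rfl⟩
      | cons y P => exact ⟨y, P ++ [z], rfl⟩
    obtain rfl : u = x := by simpa using hx
    simp only [List.cons_append] at hP hc ⊢
    obtain ⟨hu, hP⟩ := List.nodup_cons.1 hP
    have hcy : R u y := by
      rw [hyt] at hc
      exact (List.isChain_cons_cons.1 hc).1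
    have hc' : (P ++ [z]).IsChain R := hc.tail
    obtain ⟨π, hfix, hz, hπR, hsum⟩ := ih y (by rw [hyt]; rfl) hP hc'
    have huz : u ≠ z := fun h => hu (by simp [h])
    have huy : u ≠ y := fun h => hu (by simp [hyt, h])
    have hπu : π u = u := hfix u hu
    have hval : ∀ v, v ≠ z → v ≠ u → Equiv.swap u y (π v) = π v := fun v hvz hvu =>
      Equiv.swap_apply_of_ne_of_ne
        (fun h => hvu (π.injective (h.trans hπu.symm)))
        (fun h => hvz (π.injective (h.trans hz.symm)))
    -- The permutation `π` closes the path starting at `y` and fixes `u`. Composing with the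
    -- transposition inserts `u` into the cycle: `z` now goes to `u` and `u` to `y`.
    refine ⟨Equiv.swap u y * π, ?_, ?_, ?_, ?_⟩
    · intro v hv
      simp only [List.mem_cons, not_or] at hv
      rw [Equiv.Perm.mul_apply, hval v (fun h => hv.2 (by simp [h])) hv.1, hfix v hv.2]
    · simp [hz]
    · intro v hv
      rw [Equiv.Perm.mul_apply]
      by_cases hvu : v = u
      · subst hvu
        simpa [hπu] using hcy
      · rw [hval v hv hvu]
        exact hπR v hv
    · have hmem : u ∈ Finset.univ.erase z := by simp [huz]
      rw [hyt, pathWeight, ← hyt, ← hsum, ← Finset.add_sum_erase _ _ hmem,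
        ← Finset.add_sum_erase (Finset.univ.erase z) (fun v => w v (π v)) hmem]
      simp only [Equiv.Perm.mul_apply, hπu, hw, Equiv.swap_apply_left, zero_add]
      congr 1
      refine Finset.sum_congr rfl fun v hv => ?_
      simp only [Finset.mem_erase, Finset.mem_univ, and_true] at hv
      rw [hval v hv.2 hv.1]

/-- If all permutations along the relation `R` have weight at most `0`, and all weights are at
most `1`, then there is a potential whose values are less than the number of vertices. -/
theorem exists_potential (hR : ∀ x, R x x) (hw : ∀ x, w x x = 0) (hw1 : ∀ x y, w x y ≤ 1)
    (hcyc : ∀ π : Equiv.Perm β, (∀ x, R x (π x)) → ∑ x, w x (π x) ≤ 0) :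
    ∃ l : β → ℕ, (∀ x, l x < Fintype.card β) ∧ ∀ x y, R x y → (l y : ℤ) + w x y ≤ l x := by
  -- The potential at `x` is the largest weight of a simple path starting at `x`; there are finitely
  -- many such paths.
  have hmax : ∀ x, ∃ t : List β, ((x :: t).Nodup ∧ (x :: t).IsChain R) ∧
      ∀ t' : List β, (x :: t').Nodup → (x :: t').IsChain R →
        pathWeight w (x :: t') ≤ pathWeight w (x :: t) := by
    intro x
    have hfin : {t : List β | (x :: t).Nodup ∧ (x :: t).IsChain R}.Finite := by
      refine Set.Finite.subset (List.finite_length_le β (Fintype.card β)) fun t ht => ?_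
      exact (List.nodup_cons.1 ht.1).2.length_le_card
    obtain ⟨t, ht, hle⟩ := Set.exists_max_image _ (fun t => pathWeight w (x :: t)) hfin
      ⟨[], by simp⟩
    exact ⟨t, ht, fun t' h h' => hle t' ⟨h, h'⟩⟩
  choose t ht hle using hmax
  have hnn : ∀ x, 0 ≤ pathWeight w (x :: t x) := fun x => by
    simpa [pathWeight] using hle x [] (by simp) (by simp)
  refine ⟨fun x => (pathWeight w (x :: t x)).toNat, fun x => ?_, fun x y hxy => ?_⟩
  · have h1 := pathWeight_lt_length w hw1 x (t x)
    have h2 := (ht x).1.length_le_card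
    have h3 := hnn x
    change (pathWeight w (x :: t x)).toNat < _
    omega
  · rw [Int.toNat_of_nonneg (hnn x), Int.toNat_of_nonneg (hnn y)]
    -- If the best path from `y` meets `x`, its part up to `x` and the arc from `x` to `y` form a
    -- cycle of weight at most 0, and the rest competes at `x`. Otherwise `x` can be put in front of
    -- the path.
    by_cases hx : x ∈ y :: t y
    · obtain ⟨P, Q, hPQ⟩ := List.append_of_mem hx
      have hnd := (ht y).1
      have hch := (ht y).2
      rw [hPQ] at hnd hch ⊢
      have hsplit : P ++ x :: Q = (P ++ [x]) ++ Q := by simp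
      obtain ⟨π, -, hπx, hπR, hsum⟩ := exists_perm_of_path w hR hw x P y
        (by
          have := congrArg List.head? hPQ
          cases P <;> simpa using this.symm)
        (by rw [hsplit] at hnd; exact hnd.of_append_left)
        (by rw [hsplit] at hch; exact hch.left_of_append)
      have hc := hcyc π fun u => by
        by_cases hu : u = x
        · rw [hu, hπx]
          exact hxy
        · exact hπR u hu
      rw [← Finset.add_sum_erase _ _ (Finset.mem_univ x), hsum, hπx] at hc
      have hQ := hle x Q hnd.of_append_right hch.right_of_append
      rw [pathWeight_append]
      linarith
    · have := hle x (y :: t y) (List.nodup_cons.2 ⟨hx, (ht y).1⟩)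
        (List.isChain_cons_cons.2 ⟨hxy, (ht y).2⟩)
      rw [pathWeight] at this
      linarith

end Potential

/-! ### Correctness of the level algorithm -/

open Classical in
/-- The indicator of a proposition. -/
noncomputable def ind (p : Prop) : ℕ := if p then 1 else 0

theorem ind_of_true {p : Prop} (h : p) : ind p = 1 := if_pos h

theorem ind_of_false {p : Prop} (h : ¬ p) : ind p = 0 := if_neg h

theorem ind_le_one (p : Prop) : ind p ≤ 1 := by
  by_cases h : p <;> simp [ind, h]

namespace Instance

variable {n : ℕ} (I : Instance n)

theorem pref_asymm {a b b' : Fin n} (h : I.pref a b b') : ¬ I.pref a b' b :=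
  fun h' => I.pref_irrefl a b (I.pref_trans a b b' b h h')

/-- An edge `(a, b)` lies in `G_l` iff no neighbour of `a` violates the dual constraint. -/
theorem mem_levelEdges_iff (l : Fin n → ℕ) (a b : Fin n) :
    (a, b) ∈ I.levelEdges l ↔ (a, b) ∈ I.E ∧
      ∀ b', (a, b') ∈ I.E → l b' + ind (I.pref a b' b) ≤ l b + ind (I.pref a b b') := by
  have hle : ∀ b', (a, b') ∈ I.E → l b' ≤ I.topLevel l a := fun b' hb' =>
    Finset.le_sup (f := l) (by simpa using hb')
  simp only [levelEdges, Finset.mem_filter]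
  refine and_congr_right fun hab => ⟨?_, fun h => ?_⟩
  · rintro (⟨h1, h2⟩ | ⟨h1, h2, h3⟩) b' hb'
    · have h4 := hle b' hb'
      rcases h4.eq_or_lt with h5 | h5
      · rw [ind_of_false (h2 b' hb' h5)]
        omega
      · have := ind_le_one (I.pref a b' b)
        omega
    · have h4 := hle b' hb'
      rcases h4.eq_or_lt with h5 | h5
      · have h6 := h2 b' hb' h5
        rw [ind_of_true h6, ind_of_false (I.pref_asymm h6)]
        omega
      · by_cases h6 : l b' + 1 = I.topLevel l a
        · rw [ind_of_false (h3 b' hb' h6)]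
          omega
        · have := ind_le_one (I.pref a b' b)
          omega
  -- The constraint at a neighbour `c` of top level leaves only the top level and the one below it
  -- for `b`.
  · obtain ⟨c, hc, hctop⟩ : ∃ c, (a, c) ∈ I.E ∧ I.topLevel l a = l c := by
      obtain ⟨c, hc, h⟩ := Finset.exists_mem_eq_sup
        (Finset.univ.filter fun b => (a, b) ∈ I.E) ⟨b, by simpa using hab⟩ l
      exact ⟨c, by simpa using hc, h⟩
    have h1 := h c hc
    have h2 := ind_le_one (I.pref a b c)
    have h3 := hle b hab
    have hsame : ∀ b', (a, b') ∈ I.E → l b' = l b → ¬ I.pref a b' b := fun b' hb' hl hp => by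
      have h4 := h b' hb'
      rw [ind_of_true hp, ind_of_false (I.pref_asymm hp)] at h4
      omega
    by_cases h4 : l b = I.topLevel l a
    · exact Or.inl ⟨h4, fun b' hb' hl => hsame b' hb' (hl.trans h4.symm)⟩
    · refine Or.inr ⟨by omega, fun b' hb' hl => ?_, fun b' hb' hl => hsame b' hb' (by omega)⟩
      by_contra hp
      have h5 := h b' hb'
      rw [ind_of_false hp] at h5
      omega

theorem phi_eq_sum {M N : Finset (Fin n × Fin n)} {σ τ : Equiv.Perm (Fin n)}
    (hM : ∀ a b, (a, b) ∈ M ↔ σ a = b) (hN : ∀ a b, (a, b) ∈ N ↔ τ a = b) :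
    I.phi M N = ∑ a, ind (I.pref a (σ a) (τ a)) := by
  classical
  simp only [phi, hM, hN, exists_eq_left', forall_eq', ind, Finset.card_filter]

/-- Weak duality: in the sum of the constraints over all agents, both matchings collect every level
exactly once, so the levels cancel. -/
theorem isPopularAssignment_of_levelEdges {l : Fin n → ℕ} {D M : Finset (Fin n × Fin n)}
    (hM : IsPerfect D M) (hD : D ⊆ I.levelEdges l) : I.IsPopularAssignment M := by
  obtain ⟨σ, hσ⟩ := hM.exists_perm
  have hmem : ∀ a, (a, σ a) ∈ I.levelEdges l := fun a => hD (hM.1.1 ((hσ _ _).2 rfl))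
  have hmem' := fun a => (I.mem_levelEdges_iff l a (σ a)).1 (hmem a)
  refine ⟨isPerfect_of_perm hσ fun a => (hmem' a).1, fun N hN => ?_⟩
  obtain ⟨τ, hτ⟩ := hN.exists_perm
  have key : ∑ a, (l (τ a) + ind (I.pref a (τ a) (σ a))) ≤
      ∑ a, (l (σ a) + ind (I.pref a (σ a) (τ a))) :=
    Finset.sum_le_sum fun a _ => (hmem' a).2 (τ a) (hN.1.1 ((hτ _ _).2 rfl))
  rw [Finset.sum_add_distrib, Finset.sum_add_distrib, Equiv.sum_comp τ l, Equiv.sum_comp σ l,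
    ← I.phi_eq_sum hσ hτ, ← I.phi_eq_sum hτ hσ] at key
  omega

/-- Every popular assignment is a perfect matching of `G_l` for levels `l` below `n`. -/
theorem IsPopularAssignment.exists_levels {M : Finset (Fin n × Fin n)}
    (hM : I.IsPopularAssignment M) :
    ∃ l : Fin n → ℕ, (∀ b, l b < n) ∧ M ⊆ I.levelEdges l := by
  obtain ⟨σ, hσ⟩ := hM.1.exists_perm
  have hE : ∀ a, (a, σ a) ∈ I.E := fun a => hM.1.1.1 ((hσ _ _).2 rfl)
  obtain ⟨l, hl, hpot⟩ := exists_potential (β := Fin n)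
    (R := fun b b' => (σ.symm b, b') ∈ I.E)
    (fun b b' => (ind (I.pref (σ.symm b) b' b) : ℤ) - ind (I.pref (σ.symm b) b b'))
    (fun b => by simpa using hE (σ.symm b)) (fun b => by simp)
    (fun b b' => by
      have := ind_le_one (I.pref (σ.symm b) b' b)
      omega)
    (fun π hπ => by
      -- A permutation of the objects along arcs reroutes each agent from her partner to another
      -- neighbour, so it is a perfect matching, and its weight is the vote against `M`.
      have hN : IsPerfect I.E (permGraph (σ.trans π)) :=
        isPerfect_of_perm (mem_permGraph _) fun a => by simpa using hπ (σ a)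
      have hpop := hM.2 _ hN
      rw [I.phi_eq_sum hσ (mem_permGraph _), I.phi_eq_sum (mem_permGraph _) hσ] at hpop
      rw [← Equiv.sum_comp σ, Finset.sum_sub_distrib]
      push_cast at hpop
      simp only [Equiv.symm_apply_apply]
      simp only [Equiv.trans_apply] at hpop
      linarith)
  refine ⟨l, by simpa using hl, ?_⟩
  rintro ⟨a, b⟩ hab
  rw [hσ] at hab
  subst hab
  refine (I.mem_levelEdges_iff l a (σ a)).2 ⟨hE a, fun b' hb' => ?_⟩
  have := hpot (σ a) b' (by simpa using hb')
  simp only [Equiv.symm_apply_apply] at this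
  omega

/-- Deleting `F` loses no solution: an edge of `F` is forbidden or competes with a forced edge at
the same agent. -/
theorem IsSolution.disjoint_F {M : Finset (Fin n × Fin n)} (hM : I.IsSolution M)
    {e : Fin n × Fin n} (he : e ∈ M) : e ∉ I.F := by
  intro hF
  rcases Finset.mem_union.1 hF with h | h
  · exact Finset.disjoint_left.1 hM.2.2 h he
  · obtain ⟨-, f, hf, h1, h2⟩ := Finset.mem_filter.1 h
    exact h2 (congrArg Prod.snd (hM.1.1.1.2 f (hM.2.1 hf) e he (Or.inl h1)))

/-- An agent with a forced edge has all her other edges in `F`, so a perfect matching avoiding `F`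
must use the forced one. -/
theorem isSolution_of_isPerfect {l : Fin n → ℕ} {M : Finset (Fin n × Fin n)}
    (hM : IsPerfect (I.levelEdges l \ I.F) M) : I.IsSolution M := by
  have hF : ∀ e ∈ M, e ∉ I.F := fun e he => (Finset.mem_sdiff.1 (hM.1.1 he)).2
  have hpop := I.isPopularAssignment_of_levelEdges hM Finset.sdiff_subset
  refine ⟨hpop, ?_, ?_⟩
  · rintro ⟨a, b⟩ hab
    obtain ⟨b', hb'⟩ := hM.2.1 a
    by_cases hbb : b = b'
    · exact hbb ▸ hb'
    · refine absurd ?_ (hF _ hb')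
      exact Finset.mem_union_right _
        (Finset.mem_filter.2 ⟨hpop.1.1.1 hb', (a, b), hab, rfl, hbb⟩)
  · rw [Finset.disjoint_left]
    exact fun e he heM => hF e heM (Finset.mem_union_left _ he)

/-- Levels that are below the levels of a solution stay so when the objects that are unmatched
in a maximum matching are raised. -/
theorem IsSolution.raise_le {M₀ M : Finset (Fin n × Fin n)} (hM₀ : I.IsSolution M₀)
    {l₀ l : Fin n → ℕ} (hl₀ : M₀ ⊆ I.levelEdges l₀) (hl : ∀ b, l b ≤ l₀ b)
    (hM : IsMaximum (I.levelEdges l \ I.F) M) (b : Fin n) : raise l M b ≤ l₀ b := by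
  classical
  unfold raise
  split_ifs with hb
  · exact hl b
  refine (hl b).lt_of_ne fun hbl => ?_
  obtain ⟨⟨hMD, hMm⟩, hmax⟩ := hM
  -- Exchange on the set `S` of tight objects: use `M₀` on `S` and `M` outside. On `S` this has
  -- `|S|` edges, whereas `M` has fewer because `b` is a tight unmatched object.
  set S : Finset (Fin n) := Finset.univ.filter fun c => l c = l₀ c with hS
  have hmemS : ∀ c, c ∈ S ↔ l c = l₀ c := fun c => by simp [hS]
  have hdual : ∀ {a c}, (a, c) ∈ M₀ → _ := fun {a c} h => (I.mem_levelEdges_iff l₀ a c).1 (hl₀ h)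
  -- Passing from `l₀` to `l` keeps the level of a tight `c` and can only lower the others, so the
  -- constraints survive.
  have hkeep : ∀ {a c}, (a, c) ∈ M₀ → l c = l₀ c → (a, c) ∈ I.levelEdges l \ I.F := by
    intro a c hac hc
    refine Finset.mem_sdiff.2 ⟨(I.mem_levelEdges_iff l a c).2 ⟨(hdual hac).1, fun b' hb' => ?_⟩,
      IsSolution.disjoint_F I hM₀ hac⟩
    have h1 := (hdual hac).2 b' hb'
    have h2 := hl b'
    omega
  -- The constraints for `l` and for `l₀` between `c` and `c'` carry opposite votes; added up they
  -- force `c'` to be tight as well. Hence the two halves share no agent.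
  have hstay : ∀ {a c c'}, (a, c) ∈ M₀ → l c = l₀ c → (a, c') ∈ M → l c' = l₀ c' := by
    intro a c c' hac hc hac'
    have h1 := (I.mem_levelEdges_iff l a c').1 (Finset.mem_sdiff.1 (hMD hac')).1
    have h2 := h1.2 c (hdual hac).1
    have h3 := (hdual hac).2 c' h1.1
    have h4 := hl c'
    omega
  have hM' : IsMatching (I.levelEdges l \ I.F)
      ((M₀.filter fun e => e.2 ∈ S) ∪ M.filter fun e => e.2 ∉ S) := by
    constructor
    · intro e he
      rcases Finset.mem_union.1 he with h | h <;> obtain ⟨h1, h2⟩ := Finset.mem_filter.1 h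
      · exact hkeep h1 ((hmemS _).1 h2)
      · exact hMD h1
    · have hcross : ∀ e f : Fin n × Fin n, e ∈ M₀ → e.2 ∈ S → f ∈ M → f.2 ∉ S →
          (e.1 = f.1 ∨ e.2 = f.2) → False := by
        rintro ⟨a, c⟩ ⟨a', c'⟩ h1 h2 h3 h4 (h | h)
        · obtain rfl : a = a' := h
          exact h4 ((hmemS _).2 (hstay h1 ((hmemS _).1 h2) h3))
        · obtain rfl : c = c' := h
          exact h4 h2
      intro e he f hf hef
      rcases Finset.mem_union.1 he with h | h <;> obtain ⟨h1, h2⟩ := Finset.mem_filter.1 h <;>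
        rcases Finset.mem_union.1 hf with h' | h' <;> obtain ⟨h1', h2'⟩ := Finset.mem_filter.1 h'
      · exact hM₀.1.1.1.2 e h1 f h1' hef
      · exact (hcross e f h1 h2 h1' h2' hef).elim
      · exact (hcross f e h1' h2' h1 h2 (hef.imp Eq.symm Eq.symm)).elim
      · exact hMm e h1 f h1' hef
  have hcard := hmax _ hM'
  have hdisj : Disjoint (M₀.filter fun e => e.2 ∈ S) (M.filter fun e => e.2 ∉ S) := by
    rw [Finset.disjoint_left]
    intro e h h'
    exact (Finset.mem_filter.1 h').2 (Finset.mem_filter.1 h).2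
  rw [Finset.card_union_of_disjoint hdisj,
    ← Finset.card_filter_add_card_filter_not (s := M) (fun e => e.2 ∈ S)] at hcard
  have h1 : S.card ≤ (M₀.filter fun e => e.2 ∈ S).card := by
    refine le_trans (Finset.card_le_card fun c hc => ?_) (Finset.card_image_le (f := Prod.snd))
    obtain ⟨a, ha⟩ := hM₀.1.1.2.2 c
    exact Finset.mem_image.2 ⟨(a, c), Finset.mem_filter.2 ⟨ha, hc⟩, rfl⟩
  have h2 : (M.filter fun e => e.2 ∈ S).card ≤ (S.erase b).card := by
    refine Finset.card_le_card_of_injOn Prod.snd (fun e he => ?_) fun e he f hf hef => ?_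
    · obtain ⟨h3, h4⟩ := Finset.mem_filter.1 he
      exact Finset.mem_erase.2 ⟨fun h => hb ⟨e.1, by rw [← h]; exact h3⟩, h4⟩
    · exact hMm e (Finset.mem_filter.1 he).1 f (Finset.mem_filter.1 hf).1 (Or.inr hef)
  have h3 : (S.erase b).card < S.card :=
    Finset.card_lt_card (Finset.erase_ssubset ((hmemS b).2 hbl))
  omega

theorem Reach.le_levels {M₀ : Finset (Fin n × Fin n)} (hM₀ : I.IsSolution M₀)
    {l₀ : Fin n → ℕ} (hl₀ : M₀ ⊆ I.levelEdges l₀) {k : ℕ} {l : Fin n → ℕ} (h : I.Reach k l) :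
    ∀ b, l b ≤ l₀ b := by
  induction h with
  | start => exact fun b => Nat.zero_le _
  | next k l M _ _ hmax _ ih => exact IsSolution.raise_le I hM₀ hl₀ ih hmax

/-- A matching that is not perfect misses some object, so each such iteration raises the sum. Levels
were below `n` before the raise, hence are at most `n` after it. -/
theorem Reach.sum_ge {k : ℕ} {l : Fin n → ℕ} (h : I.Reach k l) :
    k ≤ ∑ b, l b ∧ ∀ b, l b ≤ n := by
  induction h with
  | start => simp
  | next k l M _ hlt hmax hperf ih =>
    constructor
    · obtain ⟨b, hb⟩ : ∃ b, ¬ ∃ a, (a, b) ∈ M := by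
        by_contra! hall
        exact hperf (hmax.1.isPerfect hall)
      refine lt_of_le_of_lt ih.1 (Finset.sum_lt_sum (fun c _ => ?_) ⟨b, Finset.mem_univ b, ?_⟩)
      · unfold raise
        split_ifs <;> omega
      · simp [raise, hb]
    · intro b
      have := hlt b
      unfold raise
      split_ifs <;> omega

theorem Reach.le_sq {k : ℕ} {l : Fin n → ℕ} (h : I.Reach k l) : k ≤ n ^ 2 := by
  obtain ⟨h1, h2⟩ := Reach.sum_ge I h
  calc k ≤ ∑ b, l b := h1
    _ ≤ ∑ _b : Fin n, n := Finset.sum_le_sum fun b _ => h2 b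
    _ = n ^ 2 := by simp [sq]

theorem Returns.isSolution {M : Finset (Fin n × Fin n)} (h : I.Returns (some M)) :
    I.IsSolution M := by
  obtain ⟨k, l, -, -, -, hM⟩ := h
  exact I.isSolution_of_isPerfect hM

theorem not_returns_none {M : Finset (Fin n × Fin n)} (hM : I.IsSolution M) :
    ¬ I.Returns none := by
  rintro ⟨k, l, h, hn⟩
  obtain ⟨l₀, hlt, hl₀⟩ := IsPopularAssignment.exists_levels I hM.1
  exact hn fun b => (Reach.le_levels I hM hl₀ h b).trans_lt (hlt b)

end Instance

/-! ### Maximum matchings by an auction -/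

/-- The invariant of the auction: `o b` is `0` if the object `b` is unsold and otherwise the
successor of its owner, `p b` is the price of `b`, and every owner could not have bought a cheaper
object. -/
structure AuctionInv {n : ℕ} (D : Finset (Fin n × Fin n)) (o p : ℕ → ℕ) : Prop where
  edge : ∀ a b : Fin n, o b = a + 1 → (a, b) ∈ D
  owner_le : ∀ b : Fin n, o b ≤ n
  inj : ∀ b c : Fin n, o b = o c → o b ≠ 0 → b = c
  price_le : ∀ a b c : Fin n, o b = a + 1 → (a, c) ∈ D → p b ≤ p c + 1
  unsold : ∀ b : Fin n, o b = 0 → p b = 0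
  bound : ∀ b : Fin n, p b ≤ n + 1

/-- The agent `a` owns an object or finds all objects too expensive. -/
def Settled {n : ℕ} (D : Finset (Fin n × Fin n)) (o p : ℕ → ℕ) (a : Fin n) : Prop :=
  (∃ b : Fin n, o b = a + 1) ∨ ∀ b : Fin n, (a, b) ∈ D → n + 1 ≤ p b

/-- The matching of the objects to their owners. -/
def sold {n : ℕ} (o : ℕ → ℕ) : Finset (Fin n × Fin n) :=
  Finset.univ.filter fun e => o e.2 = e.1 + 1

theorem mem_sold {n : ℕ} {o : ℕ → ℕ} {a b : Fin n} : (a, b) ∈ sold o ↔ o b = a + 1 := by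
  simp [sold]

namespace AuctionInv

variable {n : ℕ} {D : Finset (Fin n × Fin n)} {o p : ℕ → ℕ}

theorem init (ho : ∀ b : Fin n, o b = 0) (hp : ∀ b : Fin n, p b = 0) : AuctionInv D o p where
  edge a b h := by simp [ho] at h
  owner_le b := by simp [ho]
  inj b c _ h := absurd (ho b) h
  price_le a b c h := by simp [ho] at h
  unsold b _ := hp b
  bound b := by simp [hp]

theorem exists_owner (h : AuctionInv D o p) {b : Fin n} (hb : o b ≠ 0) :
    ∃ a : Fin n, o b = a + 1 := by
  have := h.owner_le b
  exact ⟨⟨o b - 1, by omega⟩, by simp; omega⟩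

theorem isMatching (h : AuctionInv D o p) : IsMatching D (sold o) := by
  constructor
  · rintro ⟨a, b⟩ hab
    exact h.edge a b (mem_sold.1 hab)
  · rintro ⟨a, b⟩ hab ⟨a', b'⟩ hab' heq
    rw [mem_sold] at hab hab'
    rcases heq with heq | heq
    · obtain rfl : a = a' := heq
      rw [h.inj b b' (hab.trans hab'.symm) (by omega)]
    · obtain rfl : b = b' := heq
      rw [hab] at hab'
      rw [Fin.ext (Nat.succ_injective hab')]

/-- The `n` prices miss some value `v` among `0, …, n`. Objects above `v` are all sold; a settled
agent with a neighbour below `v` owns an object of price at most `v`, hence below `v`. So any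
matching injects into the sold pairs, through its object or its agent according to the side of the
gap. -/
theorem isMaximum (h : AuctionInv D o p) (hs : ∀ a, Settled D o p a) :
    IsMaximum D (sold o) := by
  refine ⟨h.isMatching, fun N hN => ?_⟩
  obtain ⟨v, hvn, hv⟩ : ∃ v ≤ n, ∀ b : Fin n, p b ≠ v := by
    by_contra! hcon
    have hsub : Finset.range (n + 1) ⊆ Finset.univ.image fun b : Fin n => p b := fun v hv => by
      obtain ⟨b, hb⟩ := hcon v (Nat.lt_succ_iff.1 (Finset.mem_range.1 hv))
      exact Finset.mem_image.2 ⟨b, Finset.mem_univ b, hb⟩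
    have h1 := (Finset.card_le_card hsub).trans Finset.card_image_le
    simp at h1
  have key : ∀ e ∈ N, ∃ m : Fin n × Fin n, m ∈ sold (n := n) o ∧
      ((v < p e.2 ∧ m.2 = e.2) ∨ (¬ v < p e.2 ∧ m.1 = e.1 ∧ p m.2 < v)) := by
    rintro ⟨a, b⟩ he
    have hab : (a, b) ∈ D := hN.1 he
    by_cases hb : v < p b
    · obtain ⟨a', ha'⟩ := h.exists_owner (b := b) fun h0 => by
        rw [h.unsold b h0] at hb
        omega
      exact ⟨(a', b), mem_sold.2 ha', Or.inl ⟨hb, rfl⟩⟩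
    · rcases hs a with ⟨c, hc⟩ | hall
      · refine ⟨(a, c), mem_sold.2 hc, Or.inr ⟨hb, rfl, ?_⟩⟩
        have h1 := h.price_le a c b hc hab
        have h2 := hv b
        have h3 := hv c
        simp only
        omega
      · have := hall b hab
        omega
  choose! f hf hfv using key
  refine Finset.card_le_card_of_injOn f (fun e he => hf e he) fun e he e' he' hee => ?_
  have h1 := hfv e he
  have h2 := hfv e' he'
  rw [← hee] at h2
  rcases h1 with ⟨h1, h3⟩ | ⟨h1, h3, h4⟩ <;> rcases h2 with ⟨h2, h5⟩ | ⟨h2, h5, h6⟩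
  · exact hN.2 e he e' he' (Or.inr (h3.symm.trans h5))
  · rw [h3] at h6
    omega
  · rw [h5] at h4
    omega
  · exact hN.2 e he e' he' (Or.inl (h3.symm.trans h5))

/-- An agent who owns nothing buys a cheapest object. -/
theorem buy (h : AuctionInv D o p) {a b : Fin n} (ha : ∀ c : Fin n, o c ≠ a + 1)
    (hab : (a, b) ∈ D) (hpb : p b ≤ n) (hmin : ∀ c : Fin n, (a, c) ∈ D → p b ≤ p c) :
    AuctionInv D (Function.update o b (a + 1)) (Function.update p b (p b + 1)) := by
  have hne : ∀ c : Fin n, c ≠ b → (c : ℕ) ≠ b := fun c hc h => hc (Fin.ext h)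
  have hpc : ∀ c : Fin n, p c ≤ Function.update p b (p b + 1) c := fun c => by
    by_cases hc : c = b
    · simp [hc]
    · rw [Function.update_of_ne (hne c hc)]
  constructor
  · intro a' c hc
    by_cases hcb : c = b
    · subst hcb
      rw [Function.update_self] at hc
      rwa [← Fin.ext (Nat.succ_injective hc)]
    · rw [Function.update_of_ne (hne c hcb)] at hc
      exact h.edge a' c hc
  · intro c
    by_cases hcb : c = b
    · subst hcb
      rw [Function.update_self]
      exact a.2
    · rw [Function.update_of_ne (hne c hcb)]
      exact h.owner_le c
  · intro c d hcd hc
    by_cases hcb : c = b <;> by_cases hdb : d = b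
    · rw [hcb, hdb]
    · subst hcb
      rw [Function.update_self, Function.update_of_ne (hne d hdb)] at hcd
      exact absurd hcd.symm (ha d)
    · subst hdb
      rw [Function.update_self, Function.update_of_ne (hne c hcb)] at hcd
      exact absurd hcd (ha c)
    · rw [Function.update_of_ne (hne c hcb)] at hcd hc
      rw [Function.update_of_ne (hne d hdb)] at hcd
      exact h.inj c d hcd hc
  · intro a' c d hc had
    -- Price increases on the right only relax the inequality, so the old prices suffice there.
    refine le_trans ?_ (Nat.add_le_add_right (hpc d) 1)
    by_cases hcb : c = b
    · subst hcb
      rw [Function.update_self] at hc ⊢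
      rw [← Fin.ext (Nat.succ_injective hc)] at had
      exact Nat.add_le_add_right (hmin d had) 1
    · rw [Function.update_of_ne (hne c hcb)] at hc ⊢
      exact h.price_le a' c d hc had
  · intro c hc
    by_cases hcb : c = b
    · subst hcb
      simp at hc
    · rw [Function.update_of_ne (hne c hcb)] at hc ⊢
      exact h.unsold c hc
  · intro c
    by_cases hcb : c = b
    · subst hcb
      rw [Function.update_self]
      omega
    · rw [Function.update_of_ne (hne c hcb)]
      exact h.bound c

/-- Every purchase raises this sum by one, so this bounds the number of purchases. -/
theorem sum_le (h : AuctionInv D o p) : ∑ b : Fin n, p b ≤ n * (n + 1) := by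
  calc ∑ b : Fin n, p b ≤ ∑ _b : Fin n, (n + 1) := Finset.sum_le_sum fun b _ => h.bound b
    _ = n * (n + 1) := by simp

end AuctionInv

theorem sum_update_succ {n : ℕ} (p : ℕ → ℕ) (b : Fin n) :
    ∑ c : Fin n, Function.update p b (p b + 1) c = (∑ c : Fin n, p c) + 1 := by
  rw [← Finset.add_sum_erase _ _ (Finset.mem_univ b),
    ← Finset.add_sum_erase _ (fun c : Fin n => p c) (Finset.mem_univ b), Function.update_self]
  have : ∑ c ∈ Finset.univ.erase b, Function.update p b (p b + 1) (c : ℕ) =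
      ∑ c ∈ Finset.univ.erase b, p c :=
    Finset.sum_congr rfl fun c hc =>
      Function.update_of_ne (fun h => (Finset.mem_erase.1 hc).1 (Fin.ext h)) _ _
  rw [this]
  ring

/-! ### Time-bounded program logic -/

namespace Store

/-- Set the register `i` to `v`. -/
def setReg (s : Store) (i v : ℕ) : Store := { s with reg := Function.update s.reg i v }

/-- Set the entry of the array `j` at the address `x` to `v`. -/
def setArr (s : Store) (j x v : ℕ) : Store :=
  { s with arr := Function.update s.arr j (Function.update (s.arr j) x v) }

theorem reg_setReg (s : Store) (i v k : ℕ) :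
    (s.setReg i v).reg k = if k = i then v else s.reg k := by
  simp [setReg, Function.update_apply]

theorem arr_setReg (s : Store) (i v : ℕ) : (s.setReg i v).arr = s.arr := rfl

theorem reg_setArr (s : Store) (j x v : ℕ) : (s.setArr j x v).reg = s.reg := rfl

theorem arr_setArr (s : Store) (j x v k : ℕ) :
    (s.setArr j x v).arr k = if k = j then Function.update (s.arr k) x v else s.arr k := by
  by_cases h : k = j
  · subst h
    simp [setArr]
  · simp [setArr, h]

end Store

namespace Prog

/-- The registers that a program writes. -/
def regs : Prog → List ℕ
  | skip => []
  | set i _ => [i]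
  | put _ _ _ => []
  | seq p q => p.regs ++ q.regs
  | ite _ p q => p.regs ++ q.regs
  | loop _ p => p.regs

/-- The arrays that a program writes. -/
def arrs : Prog → List ℕ
  | skip => []
  | set _ _ => []
  | put j _ _ => [j]
  | seq p q => p.arrs ++ q.arrs
  | ite _ p q => p.arrs ++ q.arrs
  | loop _ p => p.arrs

/-- Programs without loops. -/
def Straight : Prog → Prop
  | skip => True
  | set _ _ => True
  | put _ _ _ => True
  | seq p q => p.Straight ∧ q.Straight
  | ite _ p q => p.Straight ∧ q.Straight
  | loop _ _ => False

/-- The effect of a program without loops. -/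
def run : Prog → Store → Store
  | skip, s => s
  | set i e, s => s.setReg i (e.eval s)
  | put j e f, s => s.setArr j (e.eval s) (f.eval s)
  | seq p q, s => q.run (p.run s)
  | ite e p q, s => if e.eval s = 0 then q.run s else p.run s
  | loop _ _, s => s

/-- A bound for the running time of a program without loops. -/
def time : Prog → ℕ
  | skip => 1
  | set _ e => e.cost + 1
  | put _ e f => e.cost + f.cost + 1
  | seq p q => p.time + q.time
  | ite e p q => e.cost + 1 + (p.time + q.time)
  | loop _ _ => 0

/-- Run `body` with the register `i` going from `0` up to the value of the register `b`. -/
def forTo (i b : ℕ) (body : Prog) : Prog :=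
  seq (set i (Expr.const 0))
    (loop (Expr.sub (Expr.reg b) (Expr.reg i))
      (seq body (set i (Expr.add (Expr.reg i) (Expr.const 1)))))

end Prog

/-- Two memories that agree on everything that `P` does not write. -/
def Agree (P : Prog) (s s' : Store) : Prop :=
  (∀ i, i ∉ P.regs → s'.reg i = s.reg i) ∧ ∀ j, j ∉ P.arrs → s'.arr j = s.arr j

theorem Agree.refl (P : Prog) (s : Store) : Agree P s s := ⟨fun _ _ => rfl, fun _ _ => rfl⟩

theorem Agree.trans {P : Prog} {s s' s'' : Store} (h : Agree P s s') (h' : Agree P s' s'') :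
    Agree P s s'' :=
  ⟨fun i hi => (h'.1 i hi).trans (h.1 i hi), fun j hj => (h'.2 j hj).trans (h.2 j hj)⟩

theorem Agree.mono {P P' : Prog} {s s' : Store} (h : Agree P s s') (hr : P.regs ⊆ P'.regs)
    (ha : P.arrs ⊆ P'.arrs) : Agree P' s s' :=
  ⟨fun i hi => h.1 i fun h' => hi (hr h'), fun j hj => h.2 j fun h' => hj (ha h')⟩

/-- The frame rule. For concrete programs its side conditions are settled by `decide`. -/
theorem Exec.agree {P : Prog} {s s' : Store} {t : ℕ} (h : Exec P s t s') : Agree P s s' := by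
  induction h with
  | skip s => exact Agree.refl _ _
  | set i e s =>
    refine ⟨fun k hk => ?_, fun _ _ => rfl⟩
    exact Function.update_of_ne (by simpa [Prog.regs] using hk) _ _
  | put j e f s =>
    refine ⟨fun _ _ => rfl, fun k hk => ?_⟩
    exact Function.update_of_ne (by simpa [Prog.arrs] using hk) _ _
  | seq p q s s' s'' t t' _ _ ih ih' =>
    exact (ih.mono (List.subset_append_left _ _) (List.subset_append_left _ _)).trans
      (ih'.mono (List.subset_append_right _ _) (List.subset_append_right _ _))
  | iteTrue e p q s s' t _ _ ih =>
    exact ih.mono (List.subset_append_left _ _) (List.subset_append_left _ _)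
  | iteFalse e p q s s' t _ _ ih =>
    exact ih.mono (List.subset_append_right _ _) (List.subset_append_right _ _)
  | loopTrue e p s s' s'' t t' _ _ _ ih ih' =>
    exact Agree.trans (ih.mono (List.Subset.refl _) (List.Subset.refl _)) ih'
  | loopFalse e p s _ => exact Agree.refl _ _

/-- Started on `s`, the program `P` halts after at most `T` units of time, with a memory that
satisfies `Q`. -/
def Runs (P : Prog) (s : Store) (T : ℕ) (Q : Store → Prop) : Prop :=
  ∃ t s', Exec P s t s' ∧ t ≤ T ∧ Q s'

namespace Runs

variable {P P' : Prog} {s : Store} {T T' : ℕ} {Q Q' : Store → Prop}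

theorem mono (h : Runs P s T Q) (hT : T ≤ T') (hQ : ∀ s', Agree P s s' → Q s' → Q' s') :
    Runs P s T' Q' := by
  obtain ⟨t, s', he, ht, hq⟩ := h
  exact ⟨t, s', he, ht.trans hT, hQ s' he.agree hq⟩

theorem imp (h : Runs P s T Q) (hQ : ∀ s', Agree P s s' → Q s' → Q' s') : Runs P s T Q' :=
  h.mono le_rfl hQ

theorem seq (h : Runs P s T Q) (h' : ∀ s', Agree P s s' → Q s' → Runs P' s' T' Q') :
    Runs (Prog.seq P P') s (T + T') Q' := by
  obtain ⟨t, s', he, ht, hq⟩ := h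
  obtain ⟨t', s'', he', ht', hq'⟩ := h' s' he.agree hq
  exact ⟨t + t', s'', Exec.seq _ _ _ _ _ _ _ he he', Nat.add_le_add ht ht', hq'⟩

theorem straight (hP : P.Straight) (s : Store) : Runs P s P.time fun s' => s' = P.run s := by
  induction P generalizing s with
  | skip => exact ⟨_, _, Exec.skip s, le_rfl, rfl⟩
  | set i e => exact ⟨_, _, Exec.set i e s, le_rfl, rfl⟩
  | put j e f => exact ⟨_, _, Exec.put j e f s, le_rfl, rfl⟩
  | seq p q ihp ihq =>
    refine (ihp hP.1 s).seq fun s' _ hs' => (ihq hP.2 s').imp fun s'' _ hs'' => ?_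
    rw [hs'', hs']
    rfl
  | ite e p q ihp ihq =>
    by_cases he : e.eval s = 0
    · obtain ⟨t, s', h, ht, hq⟩ := ihq hP.2 s
      refine ⟨_, s', Exec.iteFalse e p q s s' t he h, ?_, by simp [Prog.run, he, hq]⟩
      simp only [Prog.time]
      omega
    · obtain ⟨t, s', h, ht, hq⟩ := ihp hP.1 s
      refine ⟨_, s', Exec.iteTrue e p q s s' t he h, ?_, by simp [Prog.run, he, hq]⟩
      simp only [Prog.time]
      omega
  | loop e p => exact hP.elim

theorem of_run (hP : P.Straight) (h : Q (P.run s)) : Runs P s P.time Q :=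
  (straight hP s).imp fun _ _ hs' => hs' ▸ h

theorem ite {e : Expr} (h : e.eval s ≠ 0 → Runs P s T Q) (h' : e.eval s = 0 → Runs P' s T' Q) :
    Runs (Prog.ite e P P') s (e.cost + 1 + (T + T')) Q := by
  by_cases he : e.eval s = 0
  · obtain ⟨t, s', hx, ht, hq⟩ := h' he
    exact ⟨_, s', Exec.iteFalse e _ _ s s' t he hx, by omega, hq⟩
  · obtain ⟨t, s', hx, ht, hq⟩ := h he
    exact ⟨_, s', Exec.iteTrue e _ _ s s' t he hx, by omega, hq⟩

/-- A loop with an invariant that bounds the number of its iterations by `K`. -/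
theorem loop {e : Expr} {K : ℕ} {Inv : ℕ → Store → Prop} (h0 : Inv 0 s)
    (hstep : ∀ k s', e.eval s' ≠ 0 → Agree P s s' → Inv k s' → Runs P s' T (Inv (k + 1)))
    (hK : ∀ k s', Inv k s' → k ≤ K) :
    Runs (Prog.loop e P) s ((K + 1) * (e.cost + 1 + T))
      fun s' => e.eval s' = 0 ∧ ∃ k, Inv k s' := by
  -- Here `m` is the number of guard evaluations still paid for; the `+ 1` in `K + 1` pays for the
  -- final failing test.
  have key : ∀ m k s', K + 1 ≤ m + k → Agree P s s' → Inv k s' →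
      Runs (Prog.loop e P) s' (m * (e.cost + 1 + T))
        fun s' => e.eval s' = 0 ∧ ∃ k, Inv k s' := by
    intro m
    induction m with
    | zero =>
      intro k s' hm _ hInv
      have := hK k s' hInv
      omega
    | succ m ih =>
      intro k s' hm hag hInv
      rw [Nat.succ_mul]
      by_cases he : e.eval s' = 0
      · exact ⟨_, _, Exec.loopFalse e P s' he, by omega, he, k, hInv⟩
      · obtain ⟨t, s₁, hx, ht, hq⟩ := hstep k s' he hag hInv
        obtain ⟨t', s₂, hx', ht', hq'⟩ := ih (k + 1) s₁ (by omega) (hag.trans hx.agree) hq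
        exact ⟨_, s₂, Exec.loopTrue e P s' s₁ s₂ t t' he hx hx', by omega, hq'⟩
  exact key (K + 1) 0 s (by omega) (Agree.refl _ _) h0

/-- The `8` is 4 units for the guard and 4 for the increment; the `2` is the initial assignment. The
body must establish the invariant for the memory after the increment. -/
theorem forTo {i b N : ℕ} {Inv : ℕ → Store → Prop} (hN : s.reg b = N) (hib : b ≠ i)
    (hi : i ∉ P.regs) (hb : b ∉ P.regs) (h0 : Inv 0 (s.setReg i 0))
    (hstep : ∀ k s', k < N → s'.reg i = k → Agree (Prog.forTo i b P) s s' → Inv k s' →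
      Runs P s' T fun s'' => Inv (k + 1) (s''.setReg i (k + 1))) :
    Runs (Prog.forTo i b P) s ((N + 1) * (T + 8) + 2) (Inv N) := by
  have hset : Runs (Prog.set i (Expr.const 0)) s 2 fun s' => s' = s.setReg i 0 :=
    straight (P := Prog.set i (Expr.const 0)) trivial s
  have hag0 : Agree (Prog.forTo i b P) s (s.setReg i 0) :=
    ⟨fun k hk => Function.update_of_ne
      (fun h => hk (by simp [Prog.forTo, Prog.regs, h])) _ _, fun _ _ => rfl⟩
  refine (hset.seq (T' := (N + 1) * (T + 8)) (Q' := Inv N) ?_).mono (by omega)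
    fun _ _ h => h
  rintro _ - rfl
  refine (loop (P := Prog.seq P (Prog.set i (Expr.add (Expr.reg i) (Expr.const 1))))
    (K := N) (T := T + 4) (s := s.setReg i 0)
    (Inv := fun k s' => Inv k s' ∧ s'.reg i = k ∧ s'.reg b = N ∧ k ≤ N)
    ⟨h0, ?_, ?_, Nat.zero_le _⟩ ?_ ?_).mono ?_ ?_
  · simp [Store.reg_setReg]
  · simp [Store.reg_setReg, hib, hN]
  · rintro k s' he hag ⟨hInv, hki, hkb, hle⟩
    have hlt : k < N := by
      simp only [Expr.eval, hki, hkb] at he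
      omega
    have hag' : Agree (Prog.forTo i b P) s s' := by
      refine hag0.trans (hag.mono ?_ ?_) <;> simp [Prog.forTo, Prog.regs, Prog.arrs]
    refine (hstep k s' hlt hki hag' hInv).seq fun s₁ hag₁ h₁ => ?_
    refine (straight (P := Prog.set i (Expr.add (Expr.reg i) (Expr.const 1)))
      trivial s₁).mono le_rfl ?_
    rintro _ - rfl
    have hr : s₁.reg i = k := (hag₁.1 i hi).trans hki
    have hrb : s₁.reg b = N := (hag₁.1 b hb).trans hkb
    simp only [Prog.run, Expr.eval, hr]
    refine ⟨h₁, ?_, ?_, hlt⟩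
    · simp [Store.reg_setReg]
    · simp [Store.reg_setReg, hib, hrb]
  · exact fun k s' h => h.2.2.2
  · simp only [Expr.cost]
    exact Nat.mul_le_mul_left _ (by omega)
  · rintro s' - ⟨he, k, hInv, hki, hkb, hle⟩
    simp only [Expr.eval, hki, hkb] at he
    obtain rfl : k = N := by omega
    exact hInv

end Runs

/-! ### The program -/

theorem forall_lt_succ {n k : ℕ} (hk : k < n) (p : Fin n → Prop) :
    (∀ b : Fin n, (b : ℕ) < k + 1 → p b) ↔ (∀ b : Fin n, (b : ℕ) < k → p b) ∧ p ⟨k, hk⟩ := by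
  refine ⟨fun h => ⟨fun b hb => h b (by omega), h _ (by simp)⟩, fun h b hb => ?_⟩
  by_cases hbk : (b : ℕ) = k
  · obtain rfl : b = ⟨k, hk⟩ := Fin.ext hbk
    exact h.2
  · exact h.1 b (by omega)

namespace Prog

open PopAssign.Expr

/-- Compute the next multiple of the number in register `0`. -/
def multiplesStep : Prog := put 4 (add (reg 2) (const 1)) (add (get 4 (reg 2)) (reg 0))

/-- Multiples of the number in register `0`, up to the multiplier in register `1`. -/
def multiples : Prog := forTo 2 1 multiplesStep

/-- Fill array `4` with the multiples of `n` up to `n * n * n`. -/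
def initTables : Prog :=
  seq (set 1 (reg 0)) (seq multiples (seq (set 1 (get 4 (reg 0))) multiples))

end Prog

namespace Expr

/-- The address of an entry of an `n × n` table. -/
def addr₂ (i j : ℕ) : Expr := add (get 4 (reg i)) (reg j)

/-- The address of an entry of an `n × n × n` table. -/
def addr₃ (i j k : ℕ) : Expr := add (get 4 (addr₂ i j)) (reg k)

/-- The distance of two numbers. -/
def dist (e f : Expr) : Expr := add (sub e f) (sub f e)

end Expr

namespace Prog

open PopAssign.Expr

/-- Initial value of the count of the reasons why the edge between the agent in register `4` and
the object in register `5` is not in `G_l - F`. -/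
def edgeStart : Prog :=
  set 7 (add (sub (const 1) (get 0 (addr₂ 4 5))) (get 2 (addr₂ 4 5)))

/-- Count the reasons that involve the object in register `6`. -/
def edgeStep : Prog :=
  set 7 (add (reg 7) (add
    -- For `x` in `{0, 1}`, the truncated `x - (1 - y)` is nonzero iff `x = 1` and `y > 0`; so both
    -- summands are conjunctions.
    (sub (get 0 (addr₂ 4 6)) (sub (const 1)
      (sub (add (get 5 (reg 6)) (get 3 (addr₃ 4 6 5)))
        (add (get 5 (reg 5)) (get 3 (addr₃ 4 5 6))))))
    (sub (get 1 (addr₂ 4 6)) (sub (const 1) (Expr.dist (reg 5) (reg 6))))))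

/-- Test whether the edge between the agent in register `4` and the object in register `5` is in
`G_l - F`, where array `5` holds `l`. -/
def edgeTest : Prog := seq edgeStart (forTo 6 0 edgeStep)

/-- Compare the object in register `5` with the best one so far. -/
def compareStep : Prog :=
  ite (reg 7) skip
    (ite (sub (reg 8) (get 6 (reg 5)))
      (seq (set 8 (get 6 (reg 5))) (set 9 (add (reg 5) (const 1)))) skip)

/-- Test whether the agent in register `4` owns the object in register `5`. -/
def ownerStep : Prog :=
  ite (Expr.dist (get 7 (reg 5)) (add (reg 4) (const 1))) skip (set 10 (const 1))

/-- One step of `scan`. -/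
def scanStep : Prog := seq compareStep ownerStep

/-- Initialize the search for a cheapest object. -/
def scanStart : Prog :=
  -- Starting from the price `n + 1` rules out objects that are too expensive. Register `9` holds an
  -- object plus one, so `0` means none.
  seq (set 8 (add (reg 0) (const 1))) (seq (set 9 (const 0)) (set 10 (const 0)))

/-- Find a cheapest object for the agent in register `4`, and find out whether she has one. -/
def scan : Prog := seq scanStart (forTo 5 0 (seq edgeTest scanStep))

/-- The agent in register `4` buys the object found by `scan`, if she has none. -/
def buyStep : Prog :=
  ite (reg 10) (set 4 (add (reg 4) (const 1)))
    (ite (reg 9)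
      (seq (put 7 (sub (reg 9) (const 1)) (add (reg 4) (const 1)))
        (seq (put 6 (sub (reg 9) (const 1)) (add (get 6 (sub (reg 9) (const 1))) (const 1)))
          -- A purchase may displace an earlier agent, so the pass over the agents restarts.
          (set 4 (const 0))))
      (set 4 (add (reg 4) (const 1))))

/-- Reset the owner (array `7`) and the price (array `6`) of the object in register `5`. -/
def resetStep : Prog := seq (put 6 (reg 5) (const 0)) (put 7 (reg 5) (const 0))

/-- Reset all owners and prices. -/
def reset : Prog := forTo 5 0 resetStep

/-- Compute a maximum matching by an auction. -/
def auction : Prog :=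
  seq reset (seq (set 4 (const 0)) (loop (sub (reg 0) (reg 4)) (seq scan buyStep)))

/-- Raise the level of the object in register `5` if it is unsold. -/
def raiseStep : Prog :=
  ite (get 7 (reg 5)) skip
    (seq (put 5 (reg 5) (add (get 5 (reg 5)) (const 1)))
      (seq (set 11 (const 1)) (ite (sub (reg 0) (get 5 (reg 5))) skip (set 12 (const 1)))))

/-- Raise the levels of the unsold objects; register `11` tells whether there are any, and
register `12` whether one of them arrives at level `n`. -/
def raiseLevels : Prog :=
  seq (seq (set 11 (const 0)) (set 12 (const 0))) (forTo 5 0 raiseStep)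

/-- One iteration of the level algorithm. -/
def iteration : Prog := seq auction (seq raiseLevels (set 3 (sub (reg 11) (reg 12))))

/-- Write the object in register `5` into the entry of its owner. -/
def outputStep : Prog := put 0 (sub (get 7 (reg 5)) (const 1)) (reg 5)

/-- Write the output. -/
def output : Prog :=
  ite (reg 11) (set 0 (const 0)) (seq (forTo 5 0 outputStep) (set 0 (const 1)))

/-- The level algorithm. -/
def levelAlgorithm : Prog :=
  seq initTables (seq (set 3 (const 1)) (seq (loop (reg 3) iteration) output))

end Prog

/-! ### Verification of the program -/

/-- The memory holds the instance `I` and the multiples of `n`. -/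
structure Tables {n : ℕ} (I : Instance n) (s : Store) : Prop where
  size : s.reg 0 = n
  edges : ∀ a b : Fin n, s.arr 0 (a * n + b) = ind ((a, b) ∈ I.E)
  forced : ∀ a b : Fin n, s.arr 1 (a * n + b) = ind ((a, b) ∈ I.forced)
  forbidden : ∀ a b : Fin n, s.arr 2 (a * n + b) = ind ((a, b) ∈ I.forbidden)
  prefs : ∀ a b c : Fin n, s.arr 3 ((a * n + b) * n + c) = ind (I.pref a b c)
  mul : ∀ x ≤ n * n, s.arr 4 x = x * n

theorem Tables.agree {n : ℕ} {I : Instance n} {s s' : Store} (h : Tables I s) {P : Prog}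
    (hag : Agree P s s') (h0 : 0 ∉ P.regs) (harr : ∀ j < 5, j ∉ P.arrs) : Tables I s' where
  size := (hag.1 0 h0).trans h.size
  edges := by rw [hag.2 0 (harr 0 (by norm_num))]; exact h.edges
  forced := by rw [hag.2 1 (harr 1 (by norm_num))]; exact h.forced
  forbidden := by rw [hag.2 2 (harr 2 (by norm_num))]; exact h.forbidden
  prefs := by rw [hag.2 3 (harr 3 (by norm_num))]; exact h.prefs
  mul := by rw [hag.2 4 (harr 4 (by norm_num))]; exact h.mul

theorem row_add_le {n : ℕ} (a b : Fin n) : (a : ℕ) * n + b ≤ n * n := by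
  have ha := a.2
  have hb := b.2
  nlinarith

/-- The leading parts are arbitrary numbers, so two applications decode an address with three
indices. -/
theorem row_add_inj {n : ℕ} {x y : ℕ} {b c : Fin n} (h : x * n + b = y * n + c) :
    x = y ∧ b = c := by
  have hn : 0 < n := b.pos
  have h1 : (x * n + b) / n = x := by
    rw [Nat.add_comm, Nat.add_mul_div_right _ _ hn, Nat.div_eq_of_lt b.2, zero_add]
  have h2 : (y * n + c) / n = y := by
    rw [Nat.add_comm, Nat.add_mul_div_right _ _ hn, Nat.div_eq_of_lt c.2, zero_add]
  have hxy : x = y := by rw [← h1, ← h2, h]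
  subst hxy
  exact ⟨rfl, Fin.ext (by omega)⟩

theorem ite_eq_ind {p q : Prop} {_ : Decidable p} (h : p ↔ q) : (if p then 1 else 0) = ind q := by
  by_cases hq : q
  · rw [if_pos (h.2 hq), ind_of_true hq]
  · rw [if_neg (fun hp => hq (h.1 hp)), ind_of_false hq]

namespace Instance

variable {n : ℕ} (I : Instance n)

theorem input_arr_zero (a b : Fin n) : I.input.arr 0 (a * n + b) = ind ((a, b) ∈ I.E) := by
  simp only [input, if_true]
  refine ite_eq_ind ⟨?_, fun h => ⟨a, b, rfl, h⟩⟩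
  rintro ⟨a', b', h, hE⟩
  obtain ⟨h1, h2⟩ := row_add_inj h
  rwa [Fin.ext h1, h2]

theorem input_arr_one (a b : Fin n) : I.input.arr 1 (a * n + b) = ind ((a, b) ∈ I.forced) := by
  simp only [input, if_true, one_ne_zero, if_false]
  refine ite_eq_ind ⟨?_, fun h => ⟨a, b, rfl, h⟩⟩
  rintro ⟨a', b', h, hE⟩
  obtain ⟨h1, h2⟩ := row_add_inj h
  rwa [Fin.ext h1, h2]

theorem input_arr_two (a b : Fin n) :
    I.input.arr 2 (a * n + b) = ind ((a, b) ∈ I.forbidden) := by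
  simp only [input, if_true, two_ne_zero, OfNat.ofNat_ne_one, if_false]
  refine ite_eq_ind ⟨?_, fun h => ⟨a, b, rfl, h⟩⟩
  rintro ⟨a', b', h, hE⟩
  obtain ⟨h1, h2⟩ := row_add_inj h
  rwa [Fin.ext h1, h2]

theorem input_arr_three (a b c : Fin n) :
    I.input.arr 3 ((a * n + b) * n + c) = ind (I.pref a b c) := by
  simp only [input, if_true, three_ne_zero, OfNat.ofNat_ne_one, if_false,
    show (3 : ℕ) ≠ 2 by norm_num]
  refine ite_eq_ind ⟨?_, fun h => ⟨a, b, c, rfl, h⟩⟩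
  rintro ⟨a', b', c', h, hE⟩
  obtain ⟨h1, h2⟩ := row_add_inj h
  obtain ⟨h3, h4⟩ := row_add_inj h1
  rwa [Fin.ext h3, h4, h2]

theorem input_arr_of_ge {j : ℕ} (hj : 4 ≤ j) (x : ℕ) : I.input.arr j x = 0 := by
  simp only [input]
  rw [if_neg (by omega), if_neg (by omega), if_neg (by omega), if_neg (by omega)]

end Instance

/-- Time bound of `Prog.multiples`. -/
def multiplesTime (N : ℕ) : ℕ := (N + 1) * (Prog.multiplesStep.time + 8) + 2

theorem runs_multiples {s : Store} {n N : ℕ} (h0 : s.reg 0 = n) (h1 : s.reg 1 = N)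
    (h4 : s.arr 4 0 = 0) :
    Runs Prog.multiples s (multiplesTime N) fun s' => ∀ x ≤ N, s'.arr 4 x = x * n := by
  refine Runs.forTo (Inv := fun k s' => ∀ x ≤ k, s'.arr 4 x = x * n) h1 (by decide) (by decide)
    (by decide) ?_ ?_
  · intro x hx
    obtain rfl : x = 0 := by omega
    simp [Store.arr_setReg, h4]
  · intro k s' _ hk hag hInv
    have h0' : s'.reg 0 = n := (hag.1 0 (by decide)).trans h0
    refine Runs.of_run trivial fun x hx => ?_
    simp only [Prog.run, Prog.multiplesStep, Store.arr_setReg, Store.arr_setArr, Expr.eval, hk, h0', if_true,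
      Function.update_apply, hInv k le_rfl]
    split_ifs with hxk
    · rw [hxk]
      ring
    · exact hInv x (by omega)

/-- Time bound of `Prog.initTables`. -/
def initTime (n : ℕ) : ℕ := 2 + (multiplesTime n + (3 + multiplesTime (n * n)))

theorem runs_initTables {n : ℕ} (I : Instance n) :
    Runs Prog.initTables I.input (initTime n) fun s' => Tables I s' := by
  have hn : I.input.reg 0 = n := by simp [Instance.input]
  have key : Runs Prog.initTables I.input (initTime n)
      fun s' => ∀ x ≤ n * n, s'.arr 4 x = x * n := by
    refine (Runs.straight (P := Prog.set 1 (Expr.reg 0)) trivial _).seq ?_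
    rintro _ - rfl
    simp only [Prog.run, Expr.eval, hn]
    refine (runs_multiples (s := I.input.setReg 1 n) (n := n) (N := n) (by simpa [Store.reg_setReg] using hn)
      (by simp [Store.reg_setReg]) (I.input_arr_of_ge le_rfl 0)).seq fun s₁ hag h => ?_
    have h0 : s₁.reg 0 = n := (hag.1 0 (by decide)).trans (by simpa [Store.reg_setReg] using hn)
    -- Entry `n` of the first table is `n * n`, the limit of the second pass.
    refine (Runs.straight (P := Prog.set 1 (Expr.get 4 (Expr.reg 0))) trivial _).seq ?_
    rintro _ - rfl
    simp only [Prog.run, Expr.eval, h0, h n le_rfl]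
    exact runs_multiples (by simpa [Store.reg_setReg] using h0) (by simp [Store.reg_setReg])
      (by simpa [Store.arr_setReg] using h 0 (Nat.zero_le _))
  refine key.imp fun s' hag h => ⟨(hag.1 0 (by decide)).trans hn, ?_, ?_, ?_, ?_, h⟩
  · rw [hag.2 0 (by decide)]; exact I.input_arr_zero
  · rw [hag.2 1 (by decide)]; exact I.input_arr_one
  · rw [hag.2 2 (by decide)]; exact I.input_arr_two
  · rw [hag.2 3 (by decide)]; exact I.input_arr_three

section Addresses

variable {n : ℕ} {I : Instance n} {s : Store}

theorem Tables.eval_addr₂ (h : Tables I s) {i j : ℕ} {a b : Fin n} (hi : s.reg i = a)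
    (hj : s.reg j = b) : (Expr.addr₂ i j).eval s = a * n + b := by
  have ha : (a : ℕ) ≤ n * n := by
    have := row_add_le a b
    have := b.pos
    nlinarith
  simp only [Expr.addr₂, Expr.eval, hi, hj, h.mul a ha]

theorem Tables.eval_addr₃ (h : Tables I s) {i j k : ℕ} {a b c : Fin n} (hi : s.reg i = a)
    (hj : s.reg j = b) (hk : s.reg k = c) :
    (Expr.addr₃ i j k).eval s = (a * n + b) * n + c := by
  simp only [Expr.addr₃, Expr.eval, h.eval_addr₂ hi hj, hk, h.mul _ (row_add_le a b)]

end Addresses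

theorem Expr.eval_dist (e f : Expr) (s : Store) :
    (Expr.dist e f).eval s = (e.eval s - f.eval s) + (f.eval s - e.eval s) := rfl

/-- The levels stored in array `5`. -/
def Store.levels (n : ℕ) (s : Store) (b : Fin n) : ℕ := s.arr 5 b

/-- Time bound of `Prog.edgeTest`. -/
def edgeTime (n : ℕ) : ℕ := Prog.edgeStart.time + ((n + 1) * (Prog.edgeStep.time + 8) + 2)

/-- The object `c` gives no reason to exclude the edge `(a, b)` from `G_l - F`. -/
def Instance.Allows {n : ℕ} (I : Instance n) (l : Fin n → ℕ) (a b c : Fin n) : Prop :=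
  ((a, c) ∈ I.E → l c + ind (I.pref a c b) ≤ l b + ind (I.pref a b c)) ∧
    ((a, c) ∈ I.forced → b = c)

/-- This separates one condition per object `c`, which is what a single loop over the objects can
check. -/
theorem Instance.mem_levelEdges_sdiff_iff {n : ℕ} (I : Instance n) (l : Fin n → ℕ)
    (a b : Fin n) : (a, b) ∈ I.levelEdges l \ I.F ↔
      ((a, b) ∈ I.E ∧ (a, b) ∉ I.forbidden) ∧ ∀ c, I.Allows l a b c := by
  rw [Finset.mem_sdiff, I.mem_levelEdges_iff]
  simp only [F, Finset.mem_union, Finset.mem_filter, not_or, Allows, Prod.exists]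
  constructor
  · rintro ⟨⟨h1, h2⟩, h3, h4⟩
    refine ⟨⟨h1, h3⟩, fun c => ⟨h2 c, fun hc => ?_⟩⟩
    by_contra hbc
    exact h4 ⟨h1, a, c, hc, rfl, fun h => hbc h.symm⟩
  · rintro ⟨⟨h1, h3⟩, h2⟩
    refine ⟨⟨h1, fun c => (h2 c).1⟩, h3, ?_⟩
    rintro ⟨-, a', c, hc, rfl, hne⟩
    exact hne ((h2 c).2 hc).symm

theorem runs_edgeTest {n : ℕ} {I : Instance n} {s : Store} (h : Tables I s) {a b : Fin n}
    (ha : s.reg 4 = a) (hb : s.reg 5 = b) :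
    Runs Prog.edgeTest s (edgeTime n)
      fun s' => s'.reg 7 = 0 ↔ (a, b) ∈ I.levelEdges (s.levels n) \ I.F := by
  refine (Runs.straight (P := Prog.edgeStart) trivial s).seq ?_
  rintro s₁ hag₁ hs₁
  have h₁ : Tables I s₁ := h.agree hag₁ (by decide) (by decide)
  refine (Runs.forTo (Inv := fun k s' => s'.reg 7 = 0 ↔ ((a, b) ∈ I.E ∧ (a, b) ∉ I.forbidden) ∧
    ∀ c : Fin n, (c : ℕ) < k → I.Allows (s.levels n) a b c)
    h₁.size (by decide) (by decide) (by decide) ?_ ?_).imp ?_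
  · simp only [Store.reg_setReg, hs₁, Prog.run, Prog.edgeStart, Expr.eval, h.eval_addr₂ ha hb,
      h.edges, h.forbidden]
    by_cases hE : (a, b) ∈ I.E <;> by_cases hf : (a, b) ∈ I.forbidden <;> simp [ind, hE, hf]
  · intro k s' hk hsk hag hInv
    have h' : Tables I s' := h₁.agree hag (by decide) (by decide)
    have ha' : s'.reg 4 = a := ((hag.1 4 (by decide)).trans (hag₁.1 4 (by decide))).trans ha
    have hb' : s'.reg 5 = b := ((hag.1 5 (by decide)).trans (hag₁.1 5 (by decide))).trans hb
    have hc' : s'.reg 6 = (⟨k, hk⟩ : Fin n) := hsk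
    have hlev : ∀ c : Fin n, s'.arr 5 c = s.levels n c := fun c => by
      rw [hag.2 5 (by decide), hag₁.2 5 (by decide)]
      rfl
    refine Runs.of_run trivial ?_
    rw [forall_lt_succ hk, ← and_assoc, ← hInv]
    generalize (⟨k, hk⟩ : Fin n) = c at hc'
    have hbc : b = c ↔ (b : ℕ) = c := Fin.ext_iff
    simp only [Store.reg_setReg, Prog.run, Prog.edgeStep, Expr.eval, Expr.eval_dist,
      h'.eval_addr₂ ha' hc', h'.eval_addr₃ ha' hc' hb', h'.eval_addr₃ ha' hb' hc',
      h'.edges, h'.forced, h'.prefs, hb', hc', hlev, Instance.Allows, hbc]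
    generalize s.levels n c + ind (I.pref a c b) = x
    generalize s.levels n b + ind (I.pref a b c) = y
    by_cases hE : (a, c) ∈ I.E <;> by_cases hf : (a, c) ∈ I.forced <;>
      simp only [ind, hE, hf, if_true, if_false, true_imp_iff, false_imp_iff] <;> simp <;> omega
  · intro s' _ hs'
    rw [hs', I.mem_levelEdges_sdiff_iff]
    simp

/-! ### Verification of the auction -/

/-- The state of the search of the agent `a` for a cheapest object, after `k` objects. -/
def ScanInv {n : ℕ} (D : Finset (Fin n × Fin n)) (o p : ℕ → ℕ) (a : Fin n) (k : ℕ)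
    (s : Store) : Prop :=
  (s.reg 10 = 0 ↔ ∀ b : Fin n, (b : ℕ) < k → o b ≠ a + 1) ∧
    ((s.reg 9 = 0 ∧ s.reg 8 = n + 1 ∧ ∀ b : Fin n, (b : ℕ) < k → (a, b) ∈ D → n + 1 ≤ p b) ∨
      ∃ b : Fin n, s.reg 9 = b + 1 ∧ (a, b) ∈ D ∧ s.reg 8 = p b ∧ p b ≤ n ∧
        ∀ c : Fin n, (c : ℕ) < k → (a, c) ∈ D → p b ≤ p c)

theorem ScanInv.congr {n : ℕ} {D : Finset (Fin n × Fin n)} {o p : ℕ → ℕ} {a : Fin n} {k : ℕ}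
    {s s' : Store} (h : ScanInv D o p a k s) (h8 : s'.reg 8 = s.reg 8) (h9 : s'.reg 9 = s.reg 9)
    (h10 : s'.reg 10 = s.reg 10) : ScanInv D o p a k s' := by
  simpa only [ScanInv, h8, h9, h10] using h

theorem ScanInv.step {n : ℕ} {D : Finset (Fin n × Fin n)} {a c : Fin n} {s : Store}
    (h : ScanInv D (s.arr 7) (s.arr 6) a c s) (ha : s.reg 4 = a) (hc : s.reg 5 = c)
    (hv : s.reg 7 = 0 ↔ (a, c) ∈ D) :
    ScanInv D (s.arr 7) (s.arr 6) a (c + 1) (Prog.scanStep.run s) := by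
  obtain ⟨h1, h2⟩ := h
  have hcomp : Prog.compareStep.run s = if (a, c) ∈ D ∧ s.arr 6 c < s.reg 8 then
      (s.setReg 8 (s.arr 6 c)).setReg 9 (c + 1) else s := by
    simp only [Prog.compareStep, Prog.run, Expr.eval, ← hv, hc, Nat.sub_eq_zero_iff_le]
    by_cases h7 : s.reg 7 = 0 <;> by_cases h8 : s.reg 8 ≤ s.arr 6 c <;>
      simp [h7, h8, Store.reg_setReg, hc]
  have hown : ∀ s' : Store, s'.reg 4 = a → s'.reg 5 = c → s'.arr 7 = s.arr 7 →
      Prog.ownerStep.run s' = if s.arr 7 c = a + 1 then s'.setReg 10 1 else s' := by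
    intro s' h4 h5 h7
    simp only [Prog.ownerStep, Prog.run, Expr.eval, Expr.eval_dist, h4, h5, h7]
    exact if_congr (by omega) rfl rfl
  have hrun : Prog.scanStep.run s = _ := hown (Prog.compareStep.run s)
    (by rw [hcomp]; split_ifs <;> simp [Store.reg_setReg, ha])
    (by rw [hcomp]; split_ifs <;> simp [Store.reg_setReg, hc])
    (by rw [hcomp]; split_ifs <;> simp [Store.arr_setReg])
  rw [hcomp] at hrun
  constructor
  · have hrun : (Prog.scanStep.run s).reg 10 = if s.arr 7 c = a + 1 then 1 else s.reg 10 := by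
      rw [hrun]
      split_ifs <;> simp [Store.reg_setReg]
    rw [hrun, forall_lt_succ c.2, ← h1]
    split_ifs with h <;> simp [h]
  · have hrun : (Prog.scanStep.run s).reg 9 =
          (if (a, c) ∈ D ∧ s.arr 6 c < s.reg 8 then (c : ℕ) + 1 else s.reg 9) ∧
        (Prog.scanStep.run s).reg 8 =
          if (a, c) ∈ D ∧ s.arr 6 c < s.reg 8 then s.arr 6 c else s.reg 8 := by
      rw [hrun]
      constructor <;> split_ifs <;> simp [Store.reg_setReg]
    rw [hrun.1, hrun.2]
    rcases h2 with ⟨h9, h8, hall⟩ | ⟨b, h9, hb, h8, hbn, hall⟩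
    · by_cases hlt : (a, c) ∈ D ∧ s.arr 6 c < s.reg 8
      · rw [if_pos hlt, if_pos hlt]
        have hcn := hlt.2
        rw [h8] at hcn
        refine Or.inr ⟨c, rfl, hlt.1, rfl, by omega, (forall_lt_succ c.2 _).2 ⟨?_, fun _ => le_rfl⟩⟩
        intro d hd had
        have := hall d hd had
        omega
      · rw [if_neg hlt, if_neg hlt]
        refine Or.inl ⟨h9, h8, (forall_lt_succ c.2 _).2 ⟨hall, fun had => ?_⟩⟩
        rw [h8] at hlt
        by_contra hcon
        exact hlt ⟨had, not_le.1 hcon⟩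
    · by_cases hlt : (a, c) ∈ D ∧ s.arr 6 c < s.reg 8
      · rw [if_pos hlt, if_pos hlt]
        have hcn := hlt.2
        rw [h8] at hcn
        refine Or.inr ⟨c, rfl, hlt.1, rfl, by omega, (forall_lt_succ c.2 _).2 ⟨?_, fun _ => le_rfl⟩⟩
        intro d hd had
        have := hall d hd had
        omega
      · rw [if_neg hlt, if_neg hlt]
        refine Or.inr ⟨b, h9, hb, h8, hbn, (forall_lt_succ c.2 _).2 ⟨hall, fun had => ?_⟩⟩
        rw [h8] at hlt
        by_contra hcon
        exact hlt ⟨had, not_le.1 hcon⟩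

/-- Time bound of `Prog.scan`. -/
def scanTime (n : ℕ) : ℕ :=
  Prog.scanStart.time + ((n + 1) * (edgeTime n + Prog.scanStep.time + 8) + 2)

theorem runs_scan {n : ℕ} {I : Instance n} {s : Store} (h : Tables I s) {a : Fin n}
    (ha : s.reg 4 = a) :
    Runs Prog.scan s (scanTime n)
      (ScanInv (I.levelEdges (s.levels n) \ I.F) (s.arr 7) (s.arr 6) a n) := by
  refine (Runs.straight (P := Prog.scanStart) ⟨trivial, trivial, trivial⟩ s).seq ?_
  rintro s₁ hag₁ hs₁
  have h₁ : Tables I s₁ := h.agree hag₁ (by decide) (by decide)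
  refine Runs.forTo h₁.size (by decide) (by decide) (by decide) ?_ ?_
  · refine ⟨?_, Or.inl ⟨?_, ?_, ?_⟩⟩ <;>
      simp [hs₁, Prog.scanStart, Prog.run, Expr.eval, Store.reg_setReg, h.size]
  · intro k s' hk hsk hag hInv
    have h' : Tables I s' := h₁.agree hag (by decide) (by decide)
    have ha' : s'.reg 4 = a := ((hag.1 4 (by decide)).trans (hag₁.1 4 (by decide))).trans ha
    have harr : ∀ j, s'.arr j = s.arr j := fun j =>
      (hag.2 j List.not_mem_nil).trans (hag₁.2 j List.not_mem_nil)
    have hlev : s'.levels n = s.levels n := by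
      funext b
      simp only [Store.levels, harr]
    have hc' : s'.reg 5 = (⟨k, hk⟩ : Fin n) := hsk
    refine (runs_edgeTest h' ha' hc').seq fun s₂ hag₂ hv => ?_
    refine Runs.of_run (P := Prog.scanStep) (s := s₂) ⟨⟨trivial, ⟨trivial, trivial⟩, trivial⟩,
      trivial, trivial⟩ ?_
    rw [hlev] at hv
    have harr₂ : ∀ j, s₂.arr j = s.arr j := fun j => (hag₂.2 j List.not_mem_nil).trans (harr j)
    have hInv₂ : ScanInv (I.levelEdges (s.levels n) \ I.F) (s₂.arr 7) (s₂.arr 6) a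
        (⟨k, hk⟩ : Fin n) s₂ := by
      rw [harr₂, harr₂]
      exact hInv.congr (hag₂.1 8 (by decide)) (hag₂.1 9 (by decide)) (hag₂.1 10 (by decide))
    have := hInv₂.step ((hag₂.1 4 (by decide)).trans ha') ((hag₂.1 5 (by decide)).trans hc') hv
    rw [harr₂, harr₂] at this
    exact this.congr (by simp [Store.reg_setReg]) (by simp [Store.reg_setReg])
      (by simp [Store.reg_setReg])

/-- The invariant of the loop of `Prog.auction` after `k` iterations. -/
structure AuctionLoopInv {n : ℕ} (D : Finset (Fin n × Fin n)) (k : ℕ) (s : Store) : Prop where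
  inv : AuctionInv D (s.arr 7) (s.arr 6)
  le : s.reg 4 ≤ n
  settled : ∀ a : Fin n, (a : ℕ) < s.reg 4 → Settled D (s.arr 7) (s.arr 6) a
  count : k ≤ (∑ b : Fin n, s.arr 6 b) * (n + 1) + s.reg 4

/-- In the measure of `count`, moving on to the next agent gains one; a purchase loses less than `n`
by the restart but gains `n + 1` by the price. -/
theorem AuctionLoopInv.bound {n : ℕ} {D : Finset (Fin n × Fin n)} {k : ℕ} {s : Store}
    (h : AuctionLoopInv D k s) : k ≤ n * (n + 1) * (n + 1) + n :=
  h.count.trans (Nat.add_le_add (Nat.mul_le_mul_right _ h.inv.sum_le) h.le)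

theorem AuctionLoopInv.skip {n : ℕ} {D : Finset (Fin n × Fin n)} {k : ℕ} {s : Store}
    (h : AuctionLoopInv D k s) {a : Fin n} (ha : s.reg 4 = a)
    (hs : Settled D (s.arr 7) (s.arr 6) a) :
    AuctionLoopInv D (k + 1) (s.setReg 4 (a + 1)) := by
  have hr : (s.setReg 4 (a + 1)).reg 4 = a + 1 := by simp [Store.reg_setReg]
  have hcount := h.count
  refine ⟨h.inv, hr.trans_le a.2, fun b hb => ?_, ?_⟩
  · rw [hr] at hb
    by_cases hba : b = a
    · exact hba ▸ hs
    · exact h.settled b (by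
        have := Fin.val_ne_of_ne hba
        omega)
  · rw [hr, Store.arr_setReg]
    omega

theorem AuctionLoopInv.step {n : ℕ} {D : Finset (Fin n × Fin n)} {k : ℕ} {s : Store}
    (h : AuctionLoopInv D k s) {a : Fin n} (ha : s.reg 4 = a)
    (hs : ScanInv D (s.arr 7) (s.arr 6) a n s) :
    AuctionLoopInv D (k + 1) (Prog.buyStep.run s) := by
  obtain ⟨h1, h2⟩ := hs
  by_cases h10 : s.reg 10 = 0
  · have hown : ∀ b : Fin n, s.arr 7 b ≠ a + 1 := fun b => h1.1 h10 b b.2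
    rcases h2 with ⟨h9, -, hall⟩ | ⟨b, h9, hab, -, hbn, hmin⟩
    · have hrun : Prog.buyStep.run s = s.setReg 4 (a + 1) := by
        simp [Prog.buyStep, Prog.run, Expr.eval, h10, h9, ha]
      rw [hrun]
      exact h.skip ha (Or.inr fun b hb => hall b b.2 hb)
    · have hrun : Prog.buyStep.run s =
          ((s.setArr 7 b (a + 1)).setArr 6 b (s.arr 6 b + 1)).setReg 4 0 := by
        simp [Prog.buyStep, Prog.run, Expr.eval, h10, h9, ha, Store.reg_setArr,
          Store.arr_setArr]
      have h7 : (Prog.buyStep.run s).arr 7 = Function.update (s.arr 7) b (a + 1) := by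
        simp [hrun, Store.arr_setReg, Store.arr_setArr]
      have h6 : (Prog.buyStep.run s).arr 6 = Function.update (s.arr 6) b (s.arr 6 b + 1) := by
        simp [hrun, Store.arr_setReg, Store.arr_setArr]
      have h4 : (Prog.buyStep.run s).reg 4 = 0 := by
        simp [hrun, Store.reg_setReg]
      refine ⟨?_, ?_, fun c hc => ?_, ?_⟩
      · rw [h6, h7]
        exact h.inv.buy hown hab hbn fun c hc => hmin c c.2 hc
      · rw [h4]
        exact Nat.zero_le n
      · rw [h4] at hc
        omega
      · have hcount := h.count
        have hle := a.2
        rw [h4, h6, sum_update_succ, Nat.add_one_mul]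
        omega
  · have hrun : Prog.buyStep.run s = s.setReg 4 (a + 1) := by
      simp [Prog.buyStep, Prog.run, Expr.eval, h10, ha]
    rw [hrun]
    refine h.skip ha (Or.inl ?_)
    by_contra! hcon
    exact h10 (h1.2 fun b _ => hcon b)

/-- Time bound of `Prog.reset`. -/
def resetTime (n : ℕ) : ℕ := (n + 1) * (Prog.resetStep.time + 8) + 2

theorem runs_reset {n : ℕ} {s : Store} (h : s.reg 0 = n) :
    Runs Prog.reset s (resetTime n)
      fun s' => ∀ b : Fin n, s'.arr 6 b = 0 ∧ s'.arr 7 b = 0 := by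
  refine (Runs.forTo (Inv := fun k s' => ∀ b : Fin n, (b : ℕ) < k →
    s'.arr 6 b = 0 ∧ s'.arr 7 b = 0) h (by decide) (by decide) (by decide) ?_ ?_).imp ?_
  · intro b hb
    omega
  · intro k s' hk hsk _ hInv
    refine Runs.of_run (P := Prog.resetStep) (s := s') ⟨trivial, trivial⟩ ?_
    rw [forall_lt_succ hk]
    constructor
    · intro b hb
      have := hInv b hb
      simp [Prog.resetStep, Prog.run, Expr.eval, Store.arr_setReg, Store.arr_setArr,
        Store.reg_setArr, hsk, hb.ne, this]
    · simp [Prog.resetStep, Prog.run, Expr.eval, Store.arr_setReg, Store.arr_setArr,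
        Store.reg_setArr, hsk]
  · exact fun s' _ hs' b => hs' b b.2

/-- Time bound of `Prog.auction`. -/
def auctionTime (n : ℕ) : ℕ :=
  resetTime n + (2 + (n * (n + 1) * (n + 1) + n + 1) * (4 + (scanTime n + Prog.buyStep.time)))

theorem runs_auction {n : ℕ} {I : Instance n} {s : Store} (h : Tables I s) :
    Runs Prog.auction s (auctionTime n) fun s' =>
      AuctionInv (I.levelEdges (s.levels n) \ I.F) (s'.arr 7) (s'.arr 6) ∧
        IsMaximum (I.levelEdges (s.levels n) \ I.F) (sold (s'.arr 7)) := by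
  refine (runs_reset h.size).seq fun s₁ hag₁ hs₁ => ?_
  refine (Runs.straight (P := Prog.set 4 (Expr.const 0)) trivial s₁).seq fun s₂ hag₂ hs₂ => ?_
  have h₂ : Tables I s₂ := (h.agree hag₁ (by decide) (by decide)).agree hag₂ (by decide)
    (by decide)
  have hlev₂ : s₂.levels n = s.levels n := by
    funext b
    simp only [Store.levels]
    rw [hag₂.2 5 (by decide), hag₁.2 5 (by decide)]
  have h4 : s₂.reg 4 = 0 := by
    rw [hs₂]
    simp [Prog.run, Expr.eval, Store.reg_setReg]
  refine (Runs.loop (Inv := AuctionLoopInv (I.levelEdges (s.levels n) \ I.F))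
    (K := n * (n + 1) * (n + 1) + n) ?_ ?_ fun k s' hInv => hInv.bound).imp ?_
  · refine ⟨AuctionInv.init (fun b => ?_) (fun b => ?_), ?_, fun a ha => ?_, Nat.zero_le _⟩
    · rw [hag₂.2 7 (by decide)]
      exact (hs₁ b).2
    · rw [hag₂.2 6 (by decide)]
      exact (hs₁ b).1
    · rw [h4]
      exact Nat.zero_le n
    · omega
  · intro k s₃ he hag₃ hInv
    have h₃ : Tables I s₃ := h₂.agree hag₃ (by decide) (by decide)
    have hlev₃ : s₃.levels n = s.levels n := by
      rw [← hlev₂]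
      funext b
      simp only [Store.levels]
      rw [hag₃.2 5 (by decide)]
    have hlt : s₃.reg 4 < n := by
      simp only [Expr.eval, h₃.size] at he
      omega
    refine (runs_scan h₃ (a := ⟨s₃.reg 4, hlt⟩) rfl).seq fun s₄ hag₄ hscan => ?_
    refine Runs.of_run (P := Prog.buyStep) (s := s₄)
      ⟨trivial, ⟨trivial, trivial, trivial⟩, trivial⟩ ?_
    have harr : ∀ j, s₄.arr j = s₃.arr j := fun j => hag₄.2 j List.not_mem_nil
    have hr : s₄.reg 4 = s₃.reg 4 := hag₄.1 4 (by decide)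
    rw [hlev₃, ← harr, ← harr] at hscan
    refine AuctionLoopInv.step ⟨?_, ?_, ?_, ?_⟩ hr hscan
    · rw [harr, harr]
      exact hInv.inv
    · rw [hr]
      exact hInv.le
    · rw [harr, harr, hr]
      exact hInv.settled
    · rw [harr, hr]
      exact hInv.count
  · rintro s₃ hag₃ ⟨he, k, hInv⟩
    have h₃ : Tables I s₃ := h₂.agree hag₃ (by decide) (by decide)
    simp only [Expr.eval, h₃.size] at he
    exact ⟨hInv.inv, hInv.inv.isMaximum fun a => hInv.settled a (by omega)⟩

/-! ### Verification of the main loop and the output -/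

/-- Time bound of `Prog.raiseLevels`. -/
def raiseTime (n : ℕ) : ℕ := 4 + ((n + 1) * (Prog.raiseStep.time + 8) + 2)

theorem runs_raiseLevels {n : ℕ} {s : Store} (h : s.reg 0 = n) :
    Runs Prog.raiseLevels s (raiseTime n) fun s' =>
      (∀ b, s'.levels n b = if s.arr 7 b = 0 then s.levels n b + 1 else s.levels n b) ∧
        (s'.reg 11 = if ∀ b : Fin n, s.arr 7 b ≠ 0 then 0 else 1) ∧
        s'.reg 12 = if ∀ b : Fin n, s.arr 7 b = 0 → s.levels n b + 1 < n then 0 else 1 := by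
  refine (Runs.straight (P := Prog.seq (Prog.set 11 (Expr.const 0)) (Prog.set 12 (Expr.const 0)))
    ⟨trivial, trivial⟩ s).seq fun s₁ hag₁ hs₁ => ?_
  refine (Runs.forTo (Inv := fun k s' =>
      (∀ b : Fin n, s'.arr 5 b =
        if s.arr 7 b = 0 ∧ (b : ℕ) < k then s.levels n b + 1 else s.levels n b) ∧
      (s'.reg 11 = if ∀ b : Fin n, (b : ℕ) < k → s.arr 7 b ≠ 0 then 0 else 1) ∧
      s'.reg 12 =
        if ∀ b : Fin n, (b : ℕ) < k → s.arr 7 b = 0 → s.levels n b + 1 < n then 0 else 1)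
    ((hag₁.1 0 (by decide)).trans h) (by decide) (by decide) (by decide) ?_ ?_).imp ?_
  · refine ⟨fun b => ?_, ?_, ?_⟩ <;>
      simp [hs₁, Prog.run, Expr.eval, Store.reg_setReg, Store.arr_setReg, Store.levels]
  · rintro k s' hk hsk hag ⟨hI1, hI2, hI3⟩
    have h7 : s'.arr 7 = s.arr 7 := (hag.2 7 (by decide)).trans (hag₁.2 7 (by decide))
    have h0 : s'.reg 0 = n := ((hag.1 0 (by decide)).trans (hag₁.1 0 (by decide))).trans h
    have hk5 : s'.arr 5 k = s.levels n ⟨k, hk⟩ := by simpa using hI1 ⟨k, hk⟩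
    refine Runs.of_run (P := Prog.raiseStep) (s := s')
      ⟨trivial, trivial, trivial, trivial, trivial⟩ ?_
    simp only [forall_lt_succ hk]
    by_cases hu : s.arr 7 k = 0
    · by_cases hov : s.levels n ⟨k, hk⟩ + 1 < n
      · have hrun : Prog.raiseStep.run s' =
            (s'.setArr 5 k (s.levels n ⟨k, hk⟩ + 1)).setReg 11 1 := by
          have : ¬ n ≤ s.levels n ⟨k, hk⟩ + 1 := by omega
          simp [Prog.raiseStep, Prog.run, Expr.eval, hsk, h7, hu, hk5, h0, Store.reg_setArr,
            Store.arr_setArr, Store.reg_setReg, Store.arr_setReg, Nat.sub_eq_zero_iff_le, this]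
        rw [hrun]
        refine ⟨fun b => ?_, ?_, ?_⟩
        · by_cases hbk : (b : ℕ) = k
          · obtain rfl : b = ⟨k, hk⟩ := Fin.ext hbk
            simp [Store.arr_setReg, Store.arr_setArr, hu]
          · have : (b : ℕ) < k + 1 ↔ (b : ℕ) < k := by omega
            simp [Store.arr_setReg, Store.arr_setArr, hbk, hI1, this]
        · simp [Store.reg_setReg, hu]
        · simp [Store.reg_setReg, Store.reg_setArr, hI3, hov]
      · have hrun : Prog.raiseStep.run s' =
            ((s'.setArr 5 k (s.levels n ⟨k, hk⟩ + 1)).setReg 11 1).setReg 12 1 := by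
          have : n ≤ s.levels n ⟨k, hk⟩ + 1 := by omega
          simp [Prog.raiseStep, Prog.run, Expr.eval, hsk, h7, hu, hk5, h0, Store.reg_setArr,
            Store.arr_setArr, Store.reg_setReg, Store.arr_setReg, this]
        rw [hrun]
        refine ⟨fun b => ?_, ?_, ?_⟩
        · by_cases hbk : (b : ℕ) = k
          · obtain rfl : b = ⟨k, hk⟩ := Fin.ext hbk
            simp [Store.arr_setReg, Store.arr_setArr, hu]
          · have : (b : ℕ) < k + 1 ↔ (b : ℕ) < k := by omega
            simp [Store.arr_setReg, Store.arr_setArr, hbk, hI1, this]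
        · simp [Store.reg_setReg, hu]
        · simp [Store.reg_setReg, hu, hov]
    · have hrun : Prog.raiseStep.run s' = s' := by
        simp [Prog.raiseStep, Prog.run, Expr.eval, hsk, h7, hu]
      rw [hrun]
      refine ⟨fun b => ?_, ?_, ?_⟩
      · rw [Store.arr_setReg, hI1]
        by_cases hbk : (b : ℕ) = k
        · rw [← hbk] at hu
          simp [hu]
        · have : (b : ℕ) < k + 1 ↔ (b : ℕ) < k := by omega
          simp [this]
      · simp [Store.reg_setReg, hI2, hu]
      · simp [Store.reg_setReg, hI3, hu]
  · rintro s' - ⟨h1, h2, h3⟩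
    refine ⟨fun b => ?_, ?_, ?_⟩
    · change s'.arr 5 b = _
      simpa using h1 b
    · simpa using h2
    · simpa using h3

/-- The invariant of the main loop after `k` iterations: it goes on, or a matching has been found,
or a level has reached `n`. -/
structure MainInv {n : ℕ} (I : Instance n) (k : ℕ) (s : Store) : Prop where
  tables : Tables I s
  bound : k ≤ n ^ 2 + 1
  state : (s.reg 3 ≠ 0 ∧ I.Reach k (s.levels n) ∧ ∀ b, s.levels n b < n) ∨
    (s.reg 3 = 0 ∧ s.reg 11 = 0 ∧ I.Returns (some (sold (s.arr 7)))) ∨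
    (s.reg 3 = 0 ∧ s.reg 11 ≠ 0 ∧ I.Returns none)

/-- Time bound of `Prog.iteration`. -/
def iterationTime (n : ℕ) : ℕ := auctionTime n + (raiseTime n + 4)

theorem runs_iteration {n : ℕ} {I : Instance n} {k : ℕ} {s : Store} (h : MainInv I k s)
    (h3 : s.reg 3 ≠ 0) : Runs Prog.iteration s (iterationTime n) (MainInv I (k + 1)) := by
  obtain ⟨hreach, hlt⟩ : I.Reach k (s.levels n) ∧ ∀ b, s.levels n b < n := by
    rcases h.state with h' | h' | h'
    · exact h'.2
    · exact absurd h'.1 h3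
    · exact absurd h'.1 h3
  -- The bound `n ^ 2` counts iterations that do not return; the current one may return, hence the
  -- extra one.
  have hk : k + 1 ≤ n ^ 2 + 1 := Nat.succ_le_succ hreach.le_sq
  refine (runs_auction h.tables).seq fun s₁ hag₁ hs₁ => ?_
  obtain ⟨hinv, hmax⟩ := hs₁
  have h₁ : Tables I s₁ := h.tables.agree hag₁ (by decide) (by decide)
  have hlev₁ : s₁.levels n = s.levels n := by
    funext b
    simp only [Store.levels]
    rw [hag₁.2 5 (by decide)]
  have hsold : ∀ b : Fin n, (∃ a, (a, b) ∈ sold (n := n) (s₁.arr 7)) ↔ s₁.arr 7 b ≠ 0 := by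
    intro b
    simp only [mem_sold]
    refine ⟨?_, hinv.exists_owner⟩
    rintro ⟨a, ha⟩
    omega
  refine (runs_raiseLevels h₁.size).seq fun s₂ hag₂ hs₂ => ?_
  obtain ⟨hl, h11, h12⟩ := hs₂
  have h₂ : Tables I s₂ := h₁.agree hag₂ (by decide) (by decide)
  have h7 : s₂.arr 7 = s₁.arr 7 := hag₂.2 7 (by decide)
  refine (Runs.straight (P := Prog.set 3 (Expr.sub (Expr.reg 11) (Expr.reg 12)))
    trivial s₂).imp fun s₃ hag₃ hs₃ => ?_
  have h₃ : Tables I s₃ := h₂.agree hag₃ (by decide) (by decide)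
  have h7' : s₃.arr 7 = s₁.arr 7 := (hag₃.2 7 (by decide)).trans h7
  have h11' : s₃.reg 11 = s₂.reg 11 := hag₃.1 11 (by decide)
  have h3' : s₃.reg 3 = s₂.reg 11 - s₂.reg 12 := by
    rw [hs₃]
    simp [Prog.run, Expr.eval, Store.reg_setReg]
  have hlev₃ : s₃.levels n = Instance.raise (s.levels n) (sold (s₁.arr 7)) := by
    funext b
    have : s₃.levels n b = s₂.levels n b := by
      simp only [Store.levels]
      rw [hag₃.2 5 (by decide)]
    rw [this, hl, hlev₁, Instance.raise]
    have := hsold b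
    by_cases hb : s₁.arr 7 b = 0
    · rw [if_pos hb, if_neg (fun hex => this.1 hex hb)]
    · rw [if_neg hb, if_pos (this.2 hb)]
  refine ⟨h₃, hk, ?_⟩
  by_cases hall : ∀ b : Fin n, s₁.arr 7 b ≠ 0
  · rw [if_pos hall] at h11
    refine Or.inr (Or.inl ⟨by omega, by omega, ?_⟩)
    rw [h7']
    exact ⟨k, s.levels n, hreach, hlt, hmax,
      hmax.1.isPerfect fun b => (hsold b).2 (hall b)⟩
  · rw [if_neg hall] at h11
    have hnp : ¬ IsPerfect (I.levelEdges (s.levels n) \ I.F) (sold (s₁.arr 7)) := fun hp =>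
      hall fun b => (hsold b).1 (hp.2.2 b)
    have hnext := Instance.Reach.next k (s.levels n) _ hreach hlt hmax hnp
    rw [← hlev₃] at hnext
    -- Register `12` looks only at raised objects; the others were below `n` already.
    have hiff : (∀ b : Fin n, s₁.arr 7 b = 0 → s₁.levels n b + 1 < n) ↔
        ∀ b, s₃.levels n b < n := by
      refine forall_congr' fun b => ?_
      have hb : s₃.levels n b = s₂.levels n b := by
        simp only [Store.levels]
        rw [hag₃.2 5 (by decide)]
      rw [hb, hl, hlev₁]
      have := hlt b
      split_ifs with h0 <;> simp [h0, this]
    by_cases hov : ∀ b, s₃.levels n b < n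
    · rw [if_pos (hiff.2 hov)] at h12
      exact Or.inl ⟨by omega, hnext, hov⟩
    · rw [if_neg (fun h' => hov (hiff.1 h'))] at h12
      exact Or.inr (Or.inr ⟨by omega, by omega, k + 1, s₃.levels n, hnext, hov⟩)

/-- Time bound of `Prog.output`. -/
def outputTime (n : ℕ) : ℕ := 2 + (2 + ((n + 1) * (Prog.outputStep.time + 8) + 2 + 2))

theorem runs_output {n : ℕ} {I : Instance n} {k : ℕ} {s : Store} (h : MainInv I k s)
    (h3 : s.reg 3 = 0) :
    Runs Prog.output s (outputTime n) fun s' => ∃ r : Option (Finset (Fin n × Fin n)),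
      I.Returns r ∧ s'.Shows r ∧ (s'.reg 0 = 1 ↔ r ≠ none) := by
  rcases h.state with h' | ⟨-, h11, hret⟩ | ⟨-, h11, hret⟩
  · exact absurd h3 h'.1
  · refine Runs.ite (T := 2) (fun h0 => absurd h11 h0) fun _ => ?_
    obtain ⟨_, _, _, _, _, hperf⟩ := id hret
    have hown : ∀ b : Fin n, ∃ a : Fin n, s.arr 7 b = a + 1 := fun b => by
      obtain ⟨a, ha⟩ := hperf.2.2 b
      exact ⟨a, mem_sold.1 ha⟩
    have hloop : Runs (Prog.forTo 5 0 Prog.outputStep) s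
        ((n + 1) * (Prog.outputStep.time + 8) + 2)
        fun s' => ∀ b : Fin n, (b : ℕ) < n → s'.arr 0 (s.arr 7 b - 1) = b := by
      refine Runs.forTo (Inv := fun k s' => ∀ b : Fin n, (b : ℕ) < k →
        s'.arr 0 (s.arr 7 b - 1) = b) h.tables.size (by decide) (by decide) (by decide) ?_ ?_
      · intro b hb
        omega
      · intro k s' hk hsk hag hInv
        have h7 : s'.arr 7 = s.arr 7 := hag.2 7 (by decide)
        refine Runs.of_run (P := Prog.outputStep) (s := s') trivial ?_
        have harr : (Prog.outputStep.run s').arr 0 =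
            Function.update (s'.arr 0) (s.arr 7 k - 1) k := by
          simp [Prog.outputStep, Prog.run, Expr.eval, hsk, h7, Store.arr_setArr]
        rw [forall_lt_succ hk, Store.arr_setReg, harr]
        refine ⟨fun b hb => ?_, by simp⟩
        rw [Function.update_of_ne, hInv b hb]
        -- Distinct objects have distinct owners, so no entry written earlier is overwritten.
        intro heq
        obtain ⟨a, ha⟩ := hown b
        obtain ⟨c, hc⟩ := hown ⟨k, hk⟩
        simp only at hc
        have hac : a = c := Fin.ext (by omega)
        subst hac
        have hbk := hperf.1.2 (a, b) (mem_sold.2 ha) (a, ⟨k, hk⟩) (mem_sold.2 hc) (Or.inl rfl)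
        rw [Prod.mk.injEq, Fin.ext_iff (a := b)] at hbk
        exact hb.ne hbk.2
    refine hloop.seq fun s₁ _ hs₁ => ?_
    refine (Runs.straight (P := Prog.set 0 (Expr.const 1)) trivial s₁).imp ?_
    rintro _ - rfl
    refine ⟨_, hret, ⟨by simp [Prog.run, Expr.eval, Store.reg_setReg], fun a b => ?_⟩,
      by simp [Prog.run, Expr.eval, Store.reg_setReg]⟩
    simp only [Prog.run, Store.arr_setReg, mem_sold]
    constructor
    · intro hab
      have := hs₁ b b.2
      rwa [hab, Nat.add_sub_cancel] at this
    · intro hab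
      obtain ⟨c, hc⟩ := hperf.2.1 a
      rw [mem_sold] at hc
      have := hs₁ c c.2
      rw [hc, Nat.add_sub_cancel, hab] at this
      rwa [Fin.ext this]
  · refine Runs.ite (fun _ => ?_) fun h0 => absurd h0 h11
    refine (Runs.straight (P := Prog.set 0 (Expr.const 0)) trivial s).imp ?_
    rintro _ - rfl
    exact ⟨none, hret, by simp [Store.Shows, Prog.run, Expr.eval, Store.reg_setReg],
      by simp [Prog.run, Expr.eval, Store.reg_setReg]⟩

/-- Time bound of `Prog.levelAlgorithm`. -/
def totalTime (n : ℕ) : ℕ :=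
  initTime n + (2 + ((n ^ 2 + 1 + 1) * (2 + iterationTime n) + outputTime n))

theorem runs_levelAlgorithm {n : ℕ} (I : Instance n) :
    Runs Prog.levelAlgorithm I.input (totalTime n) fun s' =>
      ∃ r : Option (Finset (Fin n × Fin n)),
        I.Returns r ∧ s'.Shows r ∧ (s'.reg 0 = 1 ↔ r ≠ none) := by
  refine (runs_initTables I).seq fun s₁ hag₁ h₁ => ?_
  refine (Runs.straight (P := Prog.set 3 (Expr.const 1)) trivial s₁).seq fun s₂ hag₂ hs₂ => ?_
  have h₂ : Tables I s₂ := h₁.agree hag₂ (by decide) (by decide)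
  have hlev : s₂.levels n = fun _ => 0 := by
    funext b
    simp only [Store.levels]
    rw [hag₂.2 5 (by decide), hag₁.2 5 (by decide), I.input_arr_of_ge (by norm_num)]
  have h3 : s₂.reg 3 = 1 := by
    rw [hs₂]
    simp [Prog.run, Expr.eval, Store.reg_setReg]
  refine (Runs.loop (Inv := MainInv I) (K := n ^ 2 + 1) ?_ ?_ fun k s' hInv => hInv.bound).seq ?_
  · refine ⟨h₂, Nat.zero_le _, Or.inl ⟨by omega, ?_, fun b => ?_⟩⟩
    · rw [hlev]
      exact Instance.Reach.start
    · rw [hlev]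
      exact b.pos
  · exact fun k s' he _ hInv => runs_iteration hInv he
  · rintro s' - ⟨he, k, hInv⟩
    exact runs_output hInv he

/-! ### Polynomial time bound -/

/-- Functions given by polynomials. -/
def IsPoly (f : ℕ → ℕ) : Prop := ∃ p : Polynomial ℕ, ∀ n, f n = p.eval n

namespace IsPoly

theorem const (c : ℕ) : IsPoly fun _ => c := ⟨Polynomial.C c, fun n => by simp⟩

theorem id : IsPoly fun n => n := ⟨Polynomial.X, fun n => by simp⟩

theorem add {f g : ℕ → ℕ} (hf : IsPoly f) (hg : IsPoly g) : IsPoly fun n => f n + g n := by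
  obtain ⟨p, hp⟩ := hf
  obtain ⟨q, hq⟩ := hg
  exact ⟨p + q, fun n => by simp [hp, hq]⟩

theorem mul {f g : ℕ → ℕ} (hf : IsPoly f) (hg : IsPoly g) : IsPoly fun n => f n * g n := by
  obtain ⟨p, hp⟩ := hf
  obtain ⟨q, hq⟩ := hg
  exact ⟨p * q, fun n => by simp [hp, hq]⟩

end IsPoly

/-- The times of the loop-free pieces are constants, so the bound is built from constants and `n` by
sums and products. -/
theorem isPoly_totalTime : IsPoly totalTime := by
  unfold totalTime initTime multiplesTime iterationTime auctionTime resetTime scanTime edgeTime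
    raiseTime outputTime
  simp only [sq]
  repeat first
    | exact IsPoly.id
    | exact IsPoly.const _
    | apply IsPoly.add
    | apply IsPoly.mul

end PopAssign

/-! ### The main theorem -/

theorem theorem5 :
    -- correctness of the level algorithm on `G_l - F`, for every choice of maximum matchings
    (∀ (n : ℕ) (I : PopAssign.Instance n),
      (∀ (k : ℕ) (l : Fin n → ℕ), I.Reach k l → k ≤ n ^ 2) ∧
      (∀ M : Finset (Fin n × Fin n), I.Returns (some M) → I.IsSolution M) ∧
      ((∃ M : Finset (Fin n × Fin n), I.IsSolution M) →
        ∀ r : Option (Finset (Fin n × Fin n)), I.Returns r →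
          ∃ M : Finset (Fin n × Fin n), r = some M ∧ I.IsSolution M)) ∧
    -- a polynomial-time program that decides the problem by the level algorithm
    (∃ (P : PopAssign.Prog) (p : Polynomial ℕ), ∀ (n : ℕ) (I : PopAssign.Instance n),
      ∃ (t : ℕ) (s : PopAssign.Store) (r : Option (Finset (Fin n × Fin n))),
        PopAssign.Exec P I.input t s ∧ t ≤ p.eval n ∧
        I.Returns r ∧ s.Shows r ∧
        (s.reg 0 = 1 ↔ ∃ M : Finset (Fin n × Fin n), I.IsSolution M)) := by
  constructor
  · refine fun n I => ⟨fun k l h => h.le_sq, fun M h => h.isSolution, ?_⟩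
    rintro ⟨M, hM⟩ (_ | N) hr
    · exact absurd hr (I.not_returns_none hM)
    · exact ⟨N, rfl, hr.isSolution⟩
  · obtain ⟨p, hp⟩ := PopAssign.isPoly_totalTime
    refine ⟨PopAssign.Prog.levelAlgorithm, p, fun n I => ?_⟩
    obtain ⟨t, s, hexec, ht, r, hr, hshow, hreg⟩ := PopAssign.runs_levelAlgorithm I
    refine ⟨t, s, r, hexec, (hp n) ▸ ht, hr, hshow, hreg.trans ⟨fun h => ?_, ?_⟩⟩
    · obtain ⟨N, rfl⟩ := Option.ne_none_iff_exists'.1 h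
      exact ⟨N, hr.isSolution⟩
    · rintro ⟨M, hM⟩ rfl
      exact I.not_returns_none hM hr
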